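/- Let $\mathbf k$ be a commutative $\mathbb Q$-algebra. Betti side. Let $\mathcal V^{B}=\mathbf kF_2$ be the group algebra of the free group $F_2$ on $X_0,X_1$, filtered by $F^n\mathcal V^{B}=\mathcal V^B$ for $n\le 0$ and $F^n\mathcal V^{B}=I^n$ for $n\ge 1$, where $I$ is the augmentation ideal. Let $\mathcal W^{B}=\mathbf k\oplus\mathcal V^{B}(X_1-1)\subset \mathcal V^B$, with the induced filtration $F^n\mathcal W^B=\mathcal W^B\cap F^n\mathcal V^B$, and equip $\mathcal W^B\otimes\mathcal W^B$ with the tensor product filtration $F^n=\sum_{i+j=n}F^i\mathcal W^B\otimes F^j\mathcal W^B$. Let $\Delta^{\mathcal W,B}:\mathcal W^B\to\mathcal W^B\otimes\mathcal W^B$ be the unique $\mathbf k$-algebra morphism such that $X_1^{-1}\mapsto X_1^{-1}\otimes X_1^{-1}$ and, for all $n\in\mathbb Z$, $$X_0^n(X_1-1)\mapsto X_0^n(X_1-1)\otimes 1+1\otimes X_0^n(X_1-1)-\sum_{a=1}^{n-1}X_0^a(X_1-1)\otimes X_0^{n-a}(X_1-1),$$ where $\sum_{a=p}^{q}f(a)$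 is $0$ if $q=p-1$ and $-f(p-1)-\cdots-f(q+1)$ if $q<p-1$. De Rham side. Let $\mathcal V^{DR}=U(\mathfrak f_2)$ be the universal enveloping algebra of the free $\mathbf k$-Lie algebra on $e_0,e_1$, graded by $\deg e_0=\deg e_1=1$. Let $\mathcal W^{DR}=\mathbf k\oplus\mathcal V^{DR}e_1\subset\mathcal V^{DR}$ with the induced grading, and equip $\mathcal W^{DR}\otimes\mathcal W^{DR}$ with the tensor product grading. Let $\Delta^{\mathcal W,DR}:\mathcal W^{DR}\to\mathcal W^{DR}\otimes\mathcal W^{DR}$ be the unique $\mathbf k$-algebra morphism such that, for all $n\ge 0$, $$e_0^ne_1\mapsto e_0^ne_1\otimes1+1\otimes e_0^ne_1-\sum_{a=0}^{n-1}e_0^ae_1\otimes e_0^{n-a-1}e_1.$$ For a decreasing filtration put $\mathrm{gr}=\bigoplus_{n\in\mathbb Z}F^n/F^{n+1}$, and write $[x]_n$ for the class of $x\in F^n$ in $F^n/F^{n+1}$. Let $\varphi:\mathrm{gr}(\mathcal V^B)\to\mathcal V^{DR}$ be the unique graded algebra isomorphism with $[X_i-1]_1\mapsto e_i$ for $i\in\{0,1\}$;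 let $\psi:\mathrm{gr}(\mathcal W^B)\to\mathcal W^{DR}$ be the unique graded algebra isomorphism compatible with $\varphi$, the map $\mathrm{gr}(\mathcal W^B)\to\mathrm{gr}(\mathcal V^B)$ induced by inclusion, and the inclusion $\mathcal W^{DR}\subset\mathcal V^{DR}$; and let $\chi:\mathrm{gr}(\mathcal W^B\otimes\mathcal W^B)\to\mathcal W^{DR}\otimes\mathcal W^{DR}$ be the unique graded algebra isomorphism with $[a\otimes b]_{m+n}\mapsto\psi([a]_m)\otimes\psi([b]_n)$ for all $m,n\in\mathbb Z$, $a\in F^m\mathcal W^B$, $b\in F^n\mathcal W^B$. Then these morphisms $\Delta^{\mathcal W,B},\Delta^{\mathcal W,DR}$ and isomorphisms $\varphi,\psi,\chi$ exist and are unique, $\Delta^{\mathcal W,B}$ is compatible with the filtrations, $\Delta^{\mathcal W,DR}$ is compatible with the gradings, and the diagram of graded algebra morphisms they form commutes: $$\chi\circ\mathrm{gr}(\Delta^{\mathcal W,B})=\Delta^{\mathcal W,DR}\circ\psi.$$ -/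

import Mathlib

open scoped DirectSum TensorProduct

noncomputable section

namespace HarmonicCoproduct

universe u v w

/-! ## Filtered algebras and their associated graded algebras -/

/-- A decreasing `ℤ`-indexed algebra filtration of a `k`-algebra `A`. -/
structure AlgFiltration (k : Type u) (A : Type v) [CommRing k] [Ring A] [Algebra k A] where
  F : ℤ → Submodule k A
  anti : Antitone F
  one_mem : (1 : A) ∈ F 0
  mul_mem : ∀ {m n : ℤ} {a b : A}, a ∈ F m → b ∈ F n → a * b ∈ F (m + n)

section Graded

variable {k : Type u} {A : Type v} {B : Type w} [CommRing k] [Ring A] [Algebra k A]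
  [Ring B] [Algebra k B]

/-- `gr_n A = F^n A / F^(n+1) A`. -/
def GrPiece (Φ : AlgFiltration k A) (n : ℤ) : Type v :=
  Φ.F n ⧸ (Φ.F (n + 1)).submoduleOf (Φ.F n)

instance instAddCommGroupGrPiece (Φ : AlgFiltration k A) (n : ℤ) : AddCommGroup (GrPiece Φ n) :=
  inferInstanceAs (AddCommGroup (Φ.F n ⧸ (Φ.F (n + 1)).submoduleOf (Φ.F n)))

instance instModuleGrPiece (Φ : AlgFiltration k A) (n : ℤ) : Module k (GrPiece Φ n) :=
  inferInstanceAs (Module k (Φ.F n ⧸ (Φ.F (n + 1)).submoduleOf (Φ.F n)))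

/-- The class `[a]_n` of `a ∈ F^n A` in `gr_n A`. -/
def grMk (Φ : AlgFiltration k A) (n : ℤ) : Φ.F n →ₗ[k] GrPiece Φ n :=
  ((Φ.F (n + 1)).submoduleOf (Φ.F n)).mkQ

theorem grMk_surjective (Φ : AlgFiltration k A) (n : ℤ) : Function.Surjective (grMk Φ n) :=
  Submodule.mkQ_surjective _

theorem grMk_eq_zero (Φ : AlgFiltration k A) (n : ℤ) (x : Φ.F n) (hx : (x : A) ∈ Φ.F (n + 1)) :
    grMk Φ n x = 0 :=
  (Submodule.Quotient.mk_eq_zero _).2 hx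

/-- Multiplication `F^m A × F^n A → F^(m+n) A`. -/
def filMul (Φ : AlgFiltration k A) (m n : ℤ) : Φ.F m →ₗ[k] Φ.F n →ₗ[k] Φ.F (m + n) :=
  LinearMap.mk₂ k (fun a b => ⟨(a : A) * b, Φ.mul_mem a.2 b.2⟩)
    (fun a a' b => Subtype.ext (add_mul (a : A) a' b))
    (fun c a b => Subtype.ext (smul_mul_assoc c (a : A) b))
    (fun a b b' => Subtype.ext (mul_add (a : A) b b'))
    (fun c a b => Subtype.ext (mul_smul_comm c (a : A) b))

/-- The map `gr_n A → Hom(F^m A, gr_(m+n) A)`, `[b]_n ↦ (a ↦ [a b]_(m+n))`. -/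
def grMulAux (Φ : AlgFiltration k A) (m n : ℤ) :
    GrPiece Φ n →ₗ[k] Φ.F m →ₗ[k] GrPiece Φ (m + n) :=
  Submodule.liftQ _ ((filMul Φ m n).compr₂ (grMk Φ (m + n))).flip (by
    intro b hb
    rw [LinearMap.mem_ker]
    ext a
    refine grMk_eq_zero Φ _ _ ?_
    have h := Φ.mul_mem a.2 (show (b : A) ∈ Φ.F (n + 1) from hb)
    rw [← add_assoc] at h
    exact h)

/-- The product `gr_m A × gr_n A → gr_(m+n) A`, `([a]_m, [b]_n) ↦ [a b]_(m+n)`. -/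
def grMul (Φ : AlgFiltration k A) (m n : ℤ) :
    GrPiece Φ m →ₗ[k] GrPiece Φ n →ₗ[k] GrPiece Φ (m + n) :=
  Submodule.liftQ _ (grMulAux Φ m n).flip (by
    intro a ha
    rw [LinearMap.mem_ker]
    refine LinearMap.ext fun y => ?_
    obtain ⟨b, rfl⟩ := grMk_surjective Φ n y
    refine grMk_eq_zero Φ (m + n) ⟨(a : A) * b, Φ.mul_mem a.2 b.2⟩ ?_
    have h := Φ.mul_mem (show (a : A) ∈ Φ.F (m + 1) from ha) b.2
    rw [show m + 1 + n = m + n + 1 by ring] at h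
    exact h)

theorem grMul_mk (Φ : AlgFiltration k A) {m n : ℤ} (a : Φ.F m) (b : Φ.F n) :
    grMul Φ m n (grMk Φ m a) (grMk Φ n b)
      = grMk Φ (m + n) ⟨(a : A) * b, Φ.mul_mem a.2 b.2⟩ := rfl

theorem sigma_grMk_eq (Φ : AlgFiltration k A) {m n : ℤ} (h : m = n) (a : Φ.F m) (b : Φ.F n)
    (hab : (a : A) = b) :
    GradedMonoid.mk (A := GrPiece Φ) m (grMk Φ m a) = GradedMonoid.mk n (grMk Φ n b) := by
  subst h
  obtain rfl : a = b := Subtype.ext hab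
  rfl

instance instGMul (Φ : AlgFiltration k A) : GradedMonoid.GMul (GrPiece Φ) where
  mul {m n} a b := grMul Φ m n a b

instance instGOne (Φ : AlgFiltration k A) : GradedMonoid.GOne (GrPiece Φ) where
  one := grMk Φ 0 ⟨1, Φ.one_mem⟩

theorem gOne_def (Φ : AlgFiltration k A) :
    (GradedMonoid.GOne.one : GrPiece Φ 0) = grMk Φ 0 ⟨1, Φ.one_mem⟩ := rfl

theorem sigma_mul_mk (Φ : AlgFiltration k A) {m n : ℤ} (a : Φ.F m) (b : Φ.F n) :
    GradedMonoid.mk (A := GrPiece Φ) m (grMk Φ m a) * GradedMonoid.mk n (grMk Φ n b)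
      = GradedMonoid.mk (m + n) (grMk Φ (m + n) ⟨(a : A) * b, Φ.mul_mem a.2 b.2⟩) := rfl

instance instGMonoid (Φ : AlgFiltration k A) : GradedMonoid.GMonoid (GrPiece Φ) where
  one_mul := by
    rintro ⟨n, x⟩
    obtain ⟨a, rfl⟩ := grMk_surjective Φ n x
    exact sigma_grMk_eq Φ (zero_add n) _ _ (one_mul (a : A))
  mul_one := by
    rintro ⟨n, x⟩
    obtain ⟨a, rfl⟩ := grMk_surjective Φ n x
    exact sigma_grMk_eq Φ (add_zero n) _ _ (mul_one (a : A))
  mul_assoc := by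
    rintro ⟨m, x⟩ ⟨n, y⟩ ⟨p, z⟩
    obtain ⟨a, rfl⟩ := grMk_surjective Φ m x
    obtain ⟨b, rfl⟩ := grMk_surjective Φ n y
    obtain ⟨c, rfl⟩ := grMk_surjective Φ p z
    exact sigma_grMk_eq Φ (add_assoc m n p) _ _ (mul_assoc (a : A) b c)

instance instGRing (Φ : AlgFiltration k A) : DirectSum.GRing (GrPiece Φ) where
  mul_zero {m n} a := (grMul Φ m n a).map_zero
  zero_mul {m n} b := LinearMap.map_zero₂ (grMul Φ m n) b
  mul_add {m n} a b c := (grMul Φ m n a).map_add b c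
  add_mul {m n} a b c := LinearMap.map_add₂ (grMul Φ m n) a b c
  natCast n := n • grMk Φ 0 ⟨1, Φ.one_mem⟩
  natCast_zero := zero_smul _ _
  natCast_succ n := succ_nsmul _ n
  intCast n := n • grMk Φ 0 ⟨1, Φ.one_mem⟩
  intCast_ofNat n := natCast_zsmul _ n
  intCast_negSucc_ofNat n := negSucc_zsmul _ n

instance instGAlgebra (Φ : AlgFiltration k A) : DirectSum.GAlgebra k (GrPiece Φ) where
  toFun :=
    { toFun := fun r => grMk Φ 0 (r • ⟨1, Φ.one_mem⟩)
      map_zero' := by rw [zero_smul, map_zero]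
      map_add' := fun r s => by rw [add_smul, map_add] }
  map_one := congrArg (grMk Φ 0) (one_smul k _)
  map_mul r s := by
    refine sigma_grMk_eq Φ (zero_add 0).symm ((r * s) • ⟨1, Φ.one_mem⟩)
      ⟨(r • (1 : A)) * (s • (1 : A)),
        Φ.mul_mem ((Φ.F 0).smul_mem r Φ.one_mem) ((Φ.F 0).smul_mem s Φ.one_mem)⟩ ?_
    simp only [Submodule.coe_smul, smul_mul_smul_comm, mul_one]
  commutes r := by
    rintro ⟨n, x⟩
    obtain ⟨a, rfl⟩ := grMk_surjective Φ n x
    refine sigma_grMk_eq Φ (add_comm 0 n)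
      ⟨(r • (1 : A)) * a, Φ.mul_mem ((Φ.F 0).smul_mem r Φ.one_mem) a.2⟩
      ⟨a * (r • (1 : A)), Φ.mul_mem a.2 ((Φ.F 0).smul_mem r Φ.one_mem)⟩ ?_
    simp
  smul_def r := by
    rintro ⟨n, x⟩
    obtain ⟨a, rfl⟩ := grMk_surjective Φ n x
    refine sigma_grMk_eq Φ (zero_add n).symm (r • a)
      ⟨(r • (1 : A)) * a, Φ.mul_mem ((Φ.F 0).smul_mem r Φ.one_mem) a.2⟩ ?_
    simp

/-- The associated graded algebra `gr A = ⨁ n, F^n A / F^(n+1) A`. -/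
abbrev Gr (Φ : AlgFiltration k A) : Type v := ⨁ n : ℤ, GrPiece Φ n

/-- The class `[a]_n`, seen in `gr A`, of an element `a ∈ F^n A`. -/
def grCls (Φ : AlgFiltration k A) (n : ℤ) (a : A) (ha : a ∈ Φ.F n) : Gr Φ :=
  DirectSum.lof k ℤ (GrPiece Φ) n (grMk Φ n ⟨a, ha⟩)

/-- The degree `n` part of `gr A`. -/
def grDeg (Φ : AlgFiltration k A) (n : ℤ) : Submodule k (Gr Φ) :=
  LinearMap.range (DirectSum.lof k ℤ (GrPiece Φ) n)

/-- `f` is compatible with the filtrations. -/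
def IsFiltered (Φ : AlgFiltration k A) (Ψ : AlgFiltration k B) (f : A →ₐ[k] B) : Prop :=
  ∀ (n : ℤ) (a : A), a ∈ Φ.F n → f a ∈ Ψ.F n

/-- `gr_n f : gr_n A → gr_n B`. -/
def grMapPiece (Φ : AlgFiltration k A) (Ψ : AlgFiltration k B) (f : A →ₐ[k] B)
    (hf : IsFiltered Φ Ψ f) (n : ℤ) : GrPiece Φ n →ₗ[k] GrPiece Ψ n :=
  Submodule.mapQ _ _ (f.toLinearMap.restrict (p := Φ.F n) (q := Ψ.F n) (hf n))
    (fun a ha => hf (n + 1) a ha)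

theorem grMapPiece_mk (Φ : AlgFiltration k A) (Ψ : AlgFiltration k B) (f : A →ₐ[k] B)
    (hf : IsFiltered Φ Ψ f) (n : ℤ) (a : Φ.F n) :
    grMapPiece Φ Ψ f hf n (grMk Φ n a) = grMk Ψ n ⟨f a, hf n a a.2⟩ := rfl

/-- The graded algebra morphism `gr f : gr A → gr B` attached to a filtered algebra morphism,
given by `[a]_n ↦ [f a]_n`. -/
def grMap (Φ : AlgFiltration k A) (Ψ : AlgFiltration k B) (f : A →ₐ[k] B)
    (hf : IsFiltered Φ Ψ f) : Gr Φ →ₐ[k] Gr Ψ :=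
  DirectSum.toAlgebra k (GrPiece Φ)
    (fun n => (DirectSum.lof k ℤ (GrPiece Ψ) n).comp (grMapPiece Φ Ψ f hf n))
    (by
      rw [gOne_def, LinearMap.comp_apply, grMapPiece_mk]
      exact congrArg (fun x => DirectSum.lof k ℤ (GrPiece Ψ) 0 (grMk Ψ 0 x))
        (Subtype.ext (map_one f)))
    (by
      intro m n x y
      obtain ⟨a, rfl⟩ := grMk_surjective Φ m x
      obtain ⟨b, rfl⟩ := grMk_surjective Φ n y
      simp only [LinearMap.comp_apply, grMapPiece_mk, DirectSum.lof_eq_of]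
      rw [DirectSum.of_mul_of]
      exact congrArg (fun x => DirectSum.of (GrPiece Ψ) (m + n) (grMk Ψ (m + n) x))
        (Subtype.ext (map_mul f (a : A) b)))

theorem grMap_grCls (Φ : AlgFiltration k A) (Ψ : AlgFiltration k B) (f : A →ₐ[k] B)
    (hf : IsFiltered Φ Ψ f) (n : ℤ) (a : A) (ha : a ∈ Φ.F n) :
    grMap Φ Ψ f hf (grCls Φ n a ha) = grCls Ψ n (f a) (hf n a ha) := by
  exact DirectSum.toAddMonoid_of _ n (grMk Φ n ⟨a, ha⟩)

/-- The filtration `F^n S = S ∩ F^n A` induced on a subalgebra `S` of `A`. -/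
def AlgFiltration.restrict (Φ : AlgFiltration k A) (S : Subalgebra k A) : AlgFiltration k S where
  F n := (Φ.F n).comap S.val.toLinearMap
  anti _ _ h _ hx := Φ.anti h hx
  one_mem := Φ.one_mem
  mul_mem ha hb := Φ.mul_mem ha hb

/-- `∑_{i+j=n} P_i ⊗ Q_j`, the sum of the images of the `P_i ⊗ Q_j` in `A ⊗ B`. -/
def tensorFamily (P : ℤ → Submodule k A) (Q : ℤ → Submodule k B) (n : ℤ) :
    Submodule k (A ⊗[k] B) :=
  ⨆ (i : ℤ) (j : ℤ) (_ : i + j = n),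
    LinearMap.range (TensorProduct.map (P i).subtype (Q j).subtype)

theorem tmul_mem_tensorFamily {P : ℤ → Submodule k A} {Q : ℤ → Submodule k B} {i j n : ℤ}
    (h : i + j = n) {a : A} {b : B} (ha : a ∈ P i) (hb : b ∈ Q j) :
    a ⊗ₜ[k] b ∈ tensorFamily P Q n := by
  refine Submodule.mem_iSup_of_mem i (Submodule.mem_iSup_of_mem j
    (Submodule.mem_iSup_of_mem h ?_))
  exact ⟨(⟨a, ha⟩ : P i) ⊗ₜ[k] (⟨b, hb⟩ : Q j), rfl⟩

theorem tensorFamily_le {P : ℤ → Submodule k A} {Q : ℤ → Submodule k B} {n : ℤ}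
    {N : Submodule k (A ⊗[k] B)}
    (h : ∀ i j : ℤ, i + j = n → ∀ a ∈ P i, ∀ b ∈ Q j, a ⊗ₜ[k] b ∈ N) :
    tensorFamily P Q n ≤ N := by
  refine iSup_le fun i => iSup_le fun j => iSup_le fun hij => ?_
  rintro _ ⟨t, rfl⟩
  induction t with
  | zero => simp
  | tmul a b => exact h i j hij a a.2 b b.2
  | add s t hs ht => rw [map_add]; exact N.add_mem hs ht

/-- The tensor product filtration `F^n(A ⊗ B) = ∑_{i+j=n} F^i A ⊗ F^j B`. -/
def AlgFiltration.tensor (Φ : AlgFiltration k A) (Ψ : AlgFiltration k B) :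
    AlgFiltration k (A ⊗[k] B) where
  F := tensorFamily Φ.F Ψ.F
  anti := by
    intro m n hmn
    refine tensorFamily_le fun i j hij a ha b hb => ?_
    exact tmul_mem_tensorFamily (i := i - (n - m)) (j := j) (by lia)
      (Φ.anti (by lia) ha) hb
  one_mem := tmul_mem_tensorFamily (add_zero 0) Φ.one_mem Ψ.one_mem
  mul_mem := by
    intro m n x y hx hy
    have h1 : ∀ i j : ℤ, i + j = m → ∀ a ∈ Φ.F i, ∀ b ∈ Ψ.F j,
        tensorFamily Φ.F Ψ.F n
          ≤ (tensorFamily Φ.F Ψ.F (m + n)).comap (LinearMap.mulLeft k (a ⊗ₜ[k] b)) := by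
      intro i j hij a ha b hb
      refine tensorFamily_le fun i' j' hij' a' ha' b' hb' => ?_
      rw [Submodule.mem_comap, LinearMap.mulLeft_apply, Algebra.TensorProduct.tmul_mul_tmul]
      exact tmul_mem_tensorFamily (i := i + i') (j := j + j') (by lia)
        (Φ.mul_mem ha ha') (Ψ.mul_mem hb hb')
    have h2 : tensorFamily Φ.F Ψ.F m
        ≤ (tensorFamily Φ.F Ψ.F (m + n)).comap (LinearMap.mulRight k y) :=
      tensorFamily_le fun i j hij a ha b hb => h1 i j hij a ha b hb hy
    exact h2 hx

end Graded

/-- The subalgebra `k ⊕ A e` of `A`. -/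
def subalgW (k : Type u) {A : Type v} [CommRing k] [Ring A] [Algebra k A] (e : A) :
    Subalgebra k A where
  carrier := {x | ∃ (c : k) (a : A), x = algebraMap k A c + a * e}
  mul_mem' := by
    rintro _ _ ⟨c, a, rfl⟩ ⟨d, b, rfl⟩
    refine ⟨c * d, c • b + d • a + a * e * b, ?_⟩
    simp only [map_mul, Algebra.algebraMap_eq_smul_one, add_mul, mul_add, smul_mul_assoc, one_mul,
      mul_smul_comm, mul_one, mul_assoc, smul_add, smul_smul, mul_comm d c]
    abel
  add_mem' := by
    rintro _ _ ⟨c, a, rfl⟩ ⟨d, b, rfl⟩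
    refine ⟨c + d, a + b, ?_⟩
    rw [map_add, add_mul]
    abel
  algebraMap_mem' c := ⟨c, 0, by simp⟩

theorem mul_mem_subalgW (k : Type u) {A : Type v} [CommRing k] [Ring A] [Algebra k A] (e a : A) :
    a * e ∈ subalgW k e :=
  ⟨0, a, by simp⟩

/-! ## The Betti side -/

section Betti

variable (k : Type u) [CommRing k]

/-- The augmentation ideal `I_G` of the group algebra `k G`: the `k`-submodule generated by the
elements `g - 1`. -/
def augIdeal (G : Type v) [Group G] : Submodule k (MonoidAlgebra k G) :=
  Submodule.span k (Set.range fun g : G => MonoidAlgebra.of k G g - 1)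

theorem top_mul_augIdeal (G : Type v) [Group G] : ⊤ * augIdeal k G ≤ augIdeal k G := by
  rw [Submodule.mul_le]
  intro x _ y hy
  induction x using MonoidAlgebra.induction_on with
  | of h =>
    have : augIdeal k G ≤ (augIdeal k G).comap
        (LinearMap.mulLeft k (MonoidAlgebra.of k G h)) := by
      refine Submodule.span_le.2 ?_
      rintro _ ⟨g, rfl⟩
      have e : MonoidAlgebra.of k G h * (MonoidAlgebra.of k G g - 1)
          = (MonoidAlgebra.of k G (h * g) - 1) - (MonoidAlgebra.of k G h - 1) := by
        rw [mul_sub, map_mul, mul_one]; abel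
      change MonoidAlgebra.of k G h * (MonoidAlgebra.of k G g - 1) ∈ augIdeal k G
      rw [e]
      exact Submodule.sub_mem _ (Submodule.subset_span ⟨_, rfl⟩) (Submodule.subset_span ⟨_, rfl⟩)
    exact this hy
  | add a b ha hb => rw [add_mul]; exact Submodule.add_mem _ (ha trivial) (hb trivial)
  | smul r a ha => rw [smul_mul_assoc]; exact Submodule.smul_mem _ _ (ha trivial)

theorem augIdeal_mul_top (G : Type v) [Group G] : augIdeal k G * ⊤ ≤ augIdeal k G := by
  rw [Submodule.mul_le]
  intro y hy x _
  induction x using MonoidAlgebra.induction_on with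
  | of h =>
    have : augIdeal k G ≤ (augIdeal k G).comap
        (LinearMap.mulRight k (MonoidAlgebra.of k G h)) := by
      refine Submodule.span_le.2 ?_
      rintro _ ⟨g, rfl⟩
      have e : (MonoidAlgebra.of k G g - 1) * MonoidAlgebra.of k G h
          = (MonoidAlgebra.of k G (g * h) - 1) - (MonoidAlgebra.of k G h - 1) := by
        rw [sub_mul, map_mul, one_mul]; abel
      change (MonoidAlgebra.of k G g - 1) * MonoidAlgebra.of k G h ∈ augIdeal k G
      rw [e]
      exact Submodule.sub_mem _ (Submodule.subset_span ⟨_, rfl⟩) (Submodule.subset_span ⟨_, rfl⟩)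
    exact this hy
  | add a b ha hb => rw [mul_add]; exact Submodule.add_mem _ (ha trivial) (hb trivial)
  | smul r a ha => rw [mul_smul_comm]; exact Submodule.smul_mem _ _ (ha trivial)

/-- `F^n(kG) = kG` for `n ≤ 0` and `F^n(kG) = I_G^n` for `n ≥ 1`. -/
def augPow (G : Type v) [Group G] (n : ℤ) : Submodule k (MonoidAlgebra k G) :=
  if n ≤ 0 then ⊤ else augIdeal k G ^ n.toNat

theorem augPow_nonpos (G : Type v) [Group G] {n : ℤ} (hn : n ≤ 0) : augPow k G n = ⊤ :=
  if_pos hn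

theorem augPow_succ (G : Type v) [Group G] (n : ℕ) :
    augPow k G ((n : ℤ) + 1) = augIdeal k G ^ (n + 1) := by
  rw [augPow, if_neg (by lia)]
  congr 1

theorem top_mul_augIdeal_pow (G : Type v) [Group G] (n : ℕ) :
    ⊤ * augIdeal k G ^ (n + 1) ≤ augIdeal k G ^ (n + 1) := by
  rw [pow_succ', ← mul_assoc]
  exact mul_le_mul' (top_mul_augIdeal k G) le_rfl

theorem augIdeal_pow_mul_top (G : Type v) [Group G] (n : ℕ) :
    augIdeal k G ^ (n + 1) * ⊤ ≤ augIdeal k G ^ (n + 1) := by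
  rw [pow_succ, mul_assoc]
  exact mul_le_mul' le_rfl (augIdeal_mul_top k G)

theorem augPow_antitone (G : Type v) [Group G] : Antitone (augPow k G) := by
  refine antitone_int_of_succ_le fun n => ?_
  rcases le_or_gt n 0 with hn | hn
  · rw [augPow_nonpos k G hn]; exact le_top
  · obtain ⟨m, rfl⟩ : ∃ m : ℕ, n = (m : ℤ) + 1 := ⟨(n - 1).toNat, by lia⟩
    have h1 := augPow_succ k G (m + 1)
    push_cast at h1
    rw [h1, augPow_succ, pow_succ' _ (m + 1)]
    exact (mul_le_mul' le_top le_rfl).trans (top_mul_augIdeal_pow k G m)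

theorem augPow_mul_le (G : Type v) [Group G] (m n : ℤ) :
    augPow k G m * augPow k G n ≤ augPow k G (m + n) := by
  rcases le_or_gt m 0 with hm | hm
  · refine le_trans ?_ (augPow_antitone k G (show m + n ≤ n by lia))
    rcases le_or_gt n 0 with hn | hn
    · rw [augPow_nonpos k G hn]; exact le_top
    · obtain ⟨p, rfl⟩ : ∃ p : ℕ, n = (p : ℤ) + 1 := ⟨(n - 1).toNat, by lia⟩
      rw [augPow_succ]
      exact (mul_le_mul' le_top le_rfl).trans (top_mul_augIdeal_pow k G p)
  · obtain ⟨q, rfl⟩ : ∃ q : ℕ, m = (q : ℤ) + 1 := ⟨(m - 1).toNat, by lia⟩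
    rcases le_or_gt n 0 with hn | hn
    · refine le_trans ?_ (augPow_antitone k G (show (q : ℤ) + 1 + n ≤ (q : ℤ) + 1 by lia))
      rw [augPow_succ]
      exact (mul_le_mul' le_rfl le_top).trans (augIdeal_pow_mul_top k G q)
    · obtain ⟨p, rfl⟩ : ∃ p : ℕ, n = (p : ℤ) + 1 := ⟨(n - 1).toNat, by lia⟩
      have h1 := augPow_succ k G (q + 1 + p)
      push_cast at h1
      rw [augPow_succ, augPow_succ, ← pow_add,
        show (q : ℤ) + 1 + (p + 1) = q + 1 + p + 1 by ring, h1]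
      exact le_of_eq (by ring_nf)

/-- The filtration of a group algebra by the powers of its augmentation ideal. -/
def augFil (G : Type v) [Group G] : AlgFiltration k (MonoidAlgebra k G) where
  F := augPow k G
  anti := augPow_antitone k G
  one_mem := by rw [augPow_nonpos k G le_rfl]; trivial
  mul_mem ha hb := augPow_mul_le k G _ _ (Submodule.mul_mem_mul ha hb)

/-- `V^B = k F_2`, the group algebra of the free group on `X_0, X_1`. -/
abbrev VB : Type u := MonoidAlgebra k (FreeGroup (Fin 2))

/-- The integral power `X_i ^ n` of a generator, in `V^B`. -/
def Xpow (i : Fin 2) (n : ℤ) : VB k :=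
  MonoidAlgebra.of k (FreeGroup (Fin 2)) (FreeGroup.of i ^ n)

/-- The generator `X_i` of `V^B`. -/
def X (i : Fin 2) : VB k := MonoidAlgebra.of k (FreeGroup (Fin 2)) (FreeGroup.of i)

/-- The filtration of `V^B`. -/
def filVB : AlgFiltration k (VB k) := augFil k (FreeGroup (Fin 2))

theorem X_sub_one_mem (i : Fin 2) : X k i - 1 ∈ (filVB k).F 1 := by
  have h := augPow_succ k (FreeGroup (Fin 2)) 0
  simp only [Nat.cast_zero, zero_add, pow_one] at h
  change X k i - 1 ∈ augPow k (FreeGroup (Fin 2)) 1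
  rw [h]
  exact Submodule.subset_span ⟨_, rfl⟩

/-- `W^B = k ⊕ V^B (X_1 - 1)`. -/
def WB : Subalgebra k (VB k) := subalgW k (X k 1 - 1)

/-- The filtration of `W^B` induced by that of `V^B`. -/
def filWB : AlgFiltration k (WB k) := (filVB k).restrict (WB k)

/-- The filtration of `W^B ⊗ W^B`. -/
def filWWB : AlgFiltration k (WB k ⊗[k] WB k) := (filWB k).tensor (filWB k)

/-- The inclusion `W^B ⊆ V^B` is compatible with the filtrations. -/
theorem isFiltered_WB_val : IsFiltered (filWB k) (filVB k) (WB k).val := fun _ _ h => h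

/-- `X_1⁻¹ = 1 - X_1⁻¹ (X_1 - 1)`, as an element of `W^B`. -/
def X1inv : WB k :=
  ⟨Xpow k 1 (-1), by
    refine ⟨1, -Xpow k 1 (-1), ?_⟩
    have h : Xpow k 1 (-1) * X k 1 = 1 := by
      rw [Xpow, X, ← map_mul, zpow_neg_one, inv_mul_cancel, map_one]
    rw [neg_mul, mul_sub, h, map_one, mul_one]
    abel⟩

/-- `X_0^n (X_1 - 1)`, for `n ∈ ℤ`, as an element of `W^B`. -/
def yB (n : ℤ) : WB k := ⟨Xpow k 0 n * (X k 1 - 1), mul_mem_subalgW k _ _⟩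

end Betti

/-- `∑_{a=p}^{q} f(a)` for arbitrary integers `p, q`: the usual sum if `q ≥ p - 1` (zero if
`q = p - 1`) and `-f(p-1) - ⋯ - f(q+1)` if `q < p - 1`. -/
def intSum {M : Type v} [AddCommGroup M] (p q : ℤ) (f : ℤ → M) : M :=
  if p - 1 ≤ q then ∑ a ∈ Finset.Icc p q, f a else -∑ a ∈ Finset.Icc (q + 1) (p - 1), f a

/-- The values on generators defining the Betti harmonic coproduct `Δ^{W,B}`. -/
def IsBettiCoproduct (k : Type u) [CommRing k] (Δ : WB k →ₐ[k] WB k ⊗[k] WB k) : Prop :=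
  Δ (X1inv k) = X1inv k ⊗ₜ[k] X1inv k ∧
  ∀ n : ℤ, Δ (yB k n) = yB k n ⊗ₜ[k] 1 + 1 ⊗ₜ[k] yB k n
    - intSum 1 (n - 1) (fun a => yB k a ⊗ₜ[k] yB k (n - a))

/-! ## The de Rham side -/

section DeRham

variable (k : Type u) [CommRing k]

/-- `V^DR = U(f_2)`, where `f_2` is the free Lie algebra on `e_0, e_1`. -/
abbrev VDR : Type u := UniversalEnvelopingAlgebra k (FreeLieAlgebra k (Fin 2))

/-- The generator `e_i` of `V^DR`. -/
def e (i : Fin 2) : VDR k :=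
  UniversalEnvelopingAlgebra.ι k (FreeLieAlgebra.of k i)

/-- The degree `n` part of `V^DR` (with `e_0, e_1` of degree one): the span of the products of `n`
generators, and zero for `n < 0`. -/
def degVDR (n : ℤ) : Submodule k (VDR k) :=
  if 0 ≤ n then Submodule.span k (Set.range (e k)) ^ n.toNat else ⊥

/-- `W^DR = k ⊕ V^DR e_1`. -/
def WDR : Subalgebra k (VDR k) := subalgW k (e k 1)

/-- The grading of `W^DR` induced by that of `V^DR`. -/
def degWDR (n : ℤ) : Submodule k (WDR k) := (degVDR k n).comap (WDR k).val.toLinearMap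

/-- The grading of `W^DR ⊗ W^DR`. -/
def degWWDR : ℤ → Submodule k (WDR k ⊗[k] WDR k) := tensorFamily (degWDR k) (degWDR k)

/-- `e_0^n e_1` as an element of `W^DR`. -/
def yDR (n : ℕ) : WDR k := ⟨e k 0 ^ n * e k 1, mul_mem_subalgW k _ _⟩

/-- The values on generators defining the de Rham harmonic coproduct `Δ^{W,DR}`. -/
def IsDeRhamCoproduct (Δ : WDR k →ₐ[k] WDR k ⊗[k] WDR k) : Prop :=
  ∀ n : ℕ, Δ (yDR k n) = yDR k n ⊗ₜ[k] 1 + 1 ⊗ₜ[k] yDR k n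
    - ∑ a ∈ Finset.range n, yDR k a ⊗ₜ[k] yDR k (n - a - 1)

end DeRham

/-! ## The comparison isomorphisms -/

section Comparison

variable {k : Type u} [CommRing k]

/-- `φ` is the graded algebra isomorphism `gr(V^B) ≃ V^DR`, `[X_i - 1]_1 ↦ e_i`. -/
def IsGrIsoV (φ : Gr (filVB k) ≃ₐ[k] VDR k) : Prop :=
  (∀ n : ℤ, (grDeg (filVB k) n).map φ.toLinearMap = degVDR k n) ∧
  ∀ i : Fin 2, φ (grCls (filVB k) 1 (X k i - 1) (X_sub_one_mem k i)) = e k i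

/-- `ψ` is the graded algebra isomorphism `gr(W^B) ≃ W^DR` induced by `φ : gr(V^B) ≃ V^DR`: it is
compatible with `gr(W^B) → gr(V^B)` and `W^DR ⊆ V^DR`. -/
def IsGrIsoW (φ : Gr (filVB k) ≃ₐ[k] VDR k) (ψ : Gr (filWB k) ≃ₐ[k] WDR k) : Prop :=
  (∀ n : ℤ, (grDeg (filWB k) n).map ψ.toLinearMap = degWDR k n) ∧
  ∀ x : Gr (filWB k),
    (ψ x : VDR k) = φ (grMap (filWB k) (filVB k) (WB k).val (isFiltered_WB_val k) x)

/-- `χ` is the graded algebra isomorphism `gr(W^B ⊗ W^B) ≃ W^DR ⊗ W^DR` induced by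
`ψ : gr(W^B) ≃ W^DR`: it sends `[a ⊗ b]_{m+n}` to `ψ[a]_m ⊗ ψ[b]_n`. -/
def IsGrIsoWW (ψ : Gr (filWB k) ≃ₐ[k] WDR k) (χ : Gr (filWWB k) ≃ₐ[k] WDR k ⊗[k] WDR k) : Prop :=
  (∀ n : ℤ, (grDeg (filWWB k) n).map χ.toLinearMap = degWWDR k n) ∧
  ∀ (m n : ℤ) (a b : WB k) (ha : a ∈ (filWB k).F m) (hb : b ∈ (filWB k).F n),
    χ (grCls (filWWB k) (m + n) (a ⊗ₜ[k] b) (tmul_mem_tensorFamily rfl ha hb))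
      = ψ (grCls (filWB k) m a ha) ⊗ₜ[k] ψ (grCls (filWB k) n b hb)

end Comparison

end HarmonicCoproduct

end

open scoped DirectSum TensorProduct

noncomputable section

namespace HarmonicCoproduct

universe u v w

/-! ## Classes in associated graded algebras -/

section GradedClasses

variable {k : Type u} {A : Type v} {B : Type w} [CommRing k] [Ring A] [Algebra k A]
  [Ring B] [Algebra k B]

/-! The group algebra is compared with `VDR` by the Magnus expansion X_i ↦ 1 + e_i T. It sends I^n
to series of order at least n, so taking leading coefficients gives an algebra morphism gr(V^B) →
V^DR. The map e_i ↦ [X_i - 1]_1 is a section of it, and this section is onto because gr(V^B) is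
generated in degree one; hence `isoV`. The same expansion restricts to W^B, giving `isoW`, and
tensors to W^B ⊗ W^B, giving `isoWW`. Every comparison map is therefore read off from one
coefficient of a power series.

Morphisms from k ⊕ V e to A come from actions of V on A-valued functions in which e acts by f ↦ y
f(o): the value at o of x applied to the constant function 1 is then multiplicative in x
(`subalgWLift`). Together with generation of k ⊕ V e (`subalgW_le`), this gives existence and
uniqueness of both coproducts.

The two coproducts are linked by finite differences in n. The m-th difference of n ↦ X_0^n (X_1 - 1)
is X_0^n (X_0 - 1)^m (X_1 - 1), which lies in F^(m+1) and has symbol e_0^m e_1. The sum in Δ^{W,B}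
is a convolution, and its difference is another convolution plus a boundary term f(n) ⊗ g(1)
(`diff_conv`). Filteredness is obtained by letting V^B act on functions whose m-th differences lie
in F^(p+m) (`isFiltered_liftWB`). In the m-th difference of the formula for Δ^{W,B}, the surviving
convolution lies in F^(m+2) and drops out of degree m+1, while the boundary terms become the de Rham
sum (`isDeRhamCoproduct_grCoproductB`). Uniqueness of Δ^{W,DR} then identifies the two sides. -/

theorem grCls_add (Φ : AlgFiltration k A) (n : ℤ) {a b : A} (ha : a ∈ Φ.F n) (hb : b ∈ Φ.F n) :
    grCls Φ n (a + b) ((Φ.F n).add_mem ha hb) = grCls Φ n a ha + grCls Φ n b hb := by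
  rw [grCls, grCls, grCls, ← map_add, ← map_add]
  rfl

theorem grCls_eq_zero (Φ : AlgFiltration k A) (n : ℤ) {a : A} (ha : a ∈ Φ.F n)
    (h : a ∈ Φ.F (n + 1)) : grCls Φ n a ha = 0 := by
  rw [grCls, grMk_eq_zero Φ n ⟨a, ha⟩ h, map_zero]

theorem grCls_mul (Φ : AlgFiltration k A) {m n : ℤ} {a b : A} (ha : a ∈ Φ.F m) (hb : b ∈ Φ.F n) :
    grCls Φ m a ha * grCls Φ n b hb = grCls Φ (m + n) (a * b) (Φ.mul_mem ha hb) := by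
  simp only [grCls, DirectSum.lof_eq_of]
  rw [DirectSum.of_mul_of]
  rfl

theorem grCls_one (Φ : AlgFiltration k A) : grCls Φ 0 1 Φ.one_mem = 1 := rfl

theorem grCls_congr (Φ : AlgFiltration k A) {m n : ℤ} (h : m = n) {a b : A} (hab : a = b)
    (ha : a ∈ Φ.F m) : grCls Φ m a ha = grCls Φ n b (h ▸ hab ▸ ha) := by
  subst h hab
  rfl

theorem mem_grDeg (Φ : AlgFiltration k A) {n : ℤ} {x : Gr Φ} :
    x ∈ grDeg Φ n ↔ ∃ (a : A) (ha : a ∈ Φ.F n), grCls Φ n a ha = x := by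
  constructor
  · rintro ⟨y, rfl⟩
    obtain ⟨⟨a, ha⟩, rfl⟩ := grMk_surjective Φ n y
    exact ⟨a, ha, rfl⟩
  · rintro ⟨a, ha, rfl⟩
    exact ⟨_, rfl⟩

theorem grCls_mem_grDeg (Φ : AlgFiltration k A) {n : ℤ} {a : A} (ha : a ∈ Φ.F n) :
    grCls Φ n a ha ∈ grDeg Φ n :=
  ⟨_, rfl⟩

theorem eq_top_of_grCls_mem (Φ : AlgFiltration k A) (S : Submodule k (Gr Φ))
    (h : ∀ (n : ℤ) (a : A) (ha : a ∈ Φ.F n), grCls Φ n a ha ∈ S) : S = ⊤ := by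
  refine eq_top_iff.2 fun x _ => ?_
  induction x using DirectSum.induction_on with
  | zero => exact S.zero_mem
  | of n y =>
    obtain ⟨⟨a, ha⟩, rfl⟩ := grMk_surjective Φ n y
    exact h n a ha
  | add x y hx hy => exact S.add_mem (hx trivial) (hy trivial)

theorem grAlgHom_ext (Φ : AlgFiltration k A) {f g : Gr Φ →ₐ[k] B}
    (h : ∀ (n : ℤ) (a : A) (ha : a ∈ Φ.F n), f (grCls Φ n a ha) = g (grCls Φ n a ha)) : f = g := by
  have := eq_top_of_grCls_mem Φ (LinearMap.eqLocus f.toLinearMap g.toLinearMap) h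
  refine AlgHom.ext fun x => ?_
  have hx : x ∈ LinearMap.eqLocus f.toLinearMap g.toLinearMap := this ▸ trivial
  exact hx

/-- The component of `gr A` in degree `n` vanishes when `F^n A = F^(n+1) A`. -/
theorem grDeg_eq_bot (Φ : AlgFiltration k A) {n : ℤ} (h : Φ.F n ≤ Φ.F (n + 1)) :
    grDeg Φ n = ⊥ := by
  refine eq_bot_iff.2 fun x hx => ?_
  obtain ⟨a, ha, rfl⟩ := (mem_grDeg Φ).1 hx
  exact grCls_eq_zero Φ n ha (h ha)

theorem isFiltered_restrict_val (Φ : AlgFiltration k A) (S : Subalgebra k A) :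
    IsFiltered (Φ.restrict S) Φ S.val := fun _ _ h => h

/-- This is where the filtration on S being the induced one matters: an element of S lying in
F^(n+1) A already lies in F^(n+1) S. -/
theorem grMapPiece_restrict_injective (Φ : AlgFiltration k A) (S : Subalgebra k A) (n : ℤ) :
    Function.Injective (grMapPiece (Φ.restrict S) Φ S.val (isFiltered_restrict_val Φ S) n) := by
  rw [← LinearMap.ker_eq_bot, eq_bot_iff]
  intro x hx
  obtain ⟨a, rfl⟩ := grMk_surjective _ n x
  rw [LinearMap.mem_ker, grMapPiece_mk] at hx
  exact grMk_eq_zero _ n a (show (⟨S.val a, a.2⟩ : Φ.F n) ∈ (Φ.F (n + 1)).submoduleOf (Φ.F n) from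
    (Submodule.Quotient.mk_eq_zero _).1 hx)

/-- Allows injectivity and homogeneity of gr f to be tested one degree at a time. -/
theorem grMap_lof (Φ : AlgFiltration k A) (Ψ : AlgFiltration k B) (f : A →ₐ[k] B)
    (hf : IsFiltered Φ Ψ f) (x : Gr Φ) (n : ℤ) :
    grMap Φ Ψ f hf x n = grMapPiece Φ Ψ f hf n (x n) := by
  induction x using DirectSum.induction_on with
  | zero => simp
  | of m y =>
    obtain ⟨a, rfl⟩ := grMk_surjective Φ m y
    have := grMap_grCls Φ Ψ f hf m a a.2
    simp only [grCls, DirectSum.lof_eq_of] at this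
    rw [this]
    by_cases h : m = n
    · subst h
      rw [DirectSum.of_eq_same, DirectSum.of_eq_same]
      rfl
    · rw [DirectSum.of_eq_of_ne _ _ _ (Ne.symm h), DirectSum.of_eq_of_ne _ _ _ (Ne.symm h),
        map_zero]
  | add x y hx hy => rw [map_add, DirectSum.add_apply, DirectSum.add_apply, hx, hy, map_add]

theorem mem_grDeg_iff_apply (Φ : AlgFiltration k A) {n : ℤ} {x : Gr Φ} :
    x ∈ grDeg Φ n ↔ ∀ m, m ≠ n → x m = 0 := by
  constructor
  · rintro ⟨y, rfl⟩ m hm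
    exact DirectSum.of_eq_of_ne _ _ _ hm
  · intro h
    refine ⟨x n, DFinsupp.ext fun m => ?_⟩
    rw [DirectSum.lof_eq_of]
    by_cases hm : m = n
    · subst hm
      exact DirectSum.of_eq_same _ _
    · rw [h m hm]
      exact DirectSum.of_eq_of_ne _ _ _ hm

theorem grMap_restrict_injective (Φ : AlgFiltration k A) (S : Subalgebra k A) :
    Function.Injective (grMap (Φ.restrict S) Φ S.val (isFiltered_restrict_val Φ S)) := by
  intro x y hxy
  refine DFinsupp.ext fun n => grMapPiece_restrict_injective Φ S n ?_
  rw [← grMap_lof, ← grMap_lof, hxy]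

theorem mem_grDeg_of_grMap_restrict (Φ : AlgFiltration k A) (S : Subalgebra k A) {n : ℤ}
    {x : Gr (Φ.restrict S)}
    (h : grMap (Φ.restrict S) Φ S.val (isFiltered_restrict_val Φ S) x ∈ grDeg Φ n) :
    x ∈ grDeg (Φ.restrict S) n := by
  rw [mem_grDeg_iff_apply] at h ⊢
  intro m hm
  refine grMapPiece_restrict_injective Φ S m ?_
  rw [← grMap_lof, h m hm, map_zero]

end GradedClasses

/-! ## Leading coefficients of power series -/

section PowerSeries

variable (k : Type u) {R : Type v} [CommRing k] [Ring R] [Algebra k R]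

/-- The coefficient of `T ^ n` of a power series, zero if `n < 0`. -/
def zcoeff (n : ℤ) : PowerSeries R →ₗ[k] R where
  toFun f := if 0 ≤ n then PowerSeries.coeff n.toNat f else 0
  map_add' f g := by split_ifs <;> simp
  map_smul' c f := by
    split_ifs
    · rfl
    · simp

theorem zcoeff_natCast (n : ℕ) (f : PowerSeries R) :
    zcoeff k (n : ℤ) f = PowerSeries.coeff n f := by
  simp [zcoeff]

theorem zcoeff_neg {n : ℤ} (hn : n < 0) (f : PowerSeries R) : zcoeff k n f = 0 :=
  if_neg (not_le.2 hn)

/-- The order bounds kill every term of the Cauchy product except the one indexed by (m, n). -/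
theorem zcoeff_mul {m n : ℤ} {f g : PowerSeries R} (hf : ∀ i < m, zcoeff k i f = 0)
    (hg : ∀ j < n, zcoeff k j g = 0) :
    zcoeff k (m + n) (f * g) = zcoeff k m f * zcoeff k n g := by
  rcases lt_or_ge (m + n) 0 with h | h
  · rcases lt_or_ge m 0 with hm | hm
    · rw [zcoeff_neg k h, zcoeff_neg k hm, zero_mul]
    · rw [zcoeff_neg k h, zcoeff_neg k (show n < 0 by lia), mul_zero]
  · obtain ⟨p, hp⟩ := Int.eq_ofNat_of_zero_le h
    rw [hp, zcoeff_natCast, PowerSeries.coeff_mul]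
    have key : ∀ q ∈ Finset.HasAntidiagonal.antidiagonal p, ((q.1 : ℤ) ≠ m) →
        PowerSeries.coeff q.1 f * PowerSeries.coeff q.2 g = 0 := by
      intro q hq hne
      rw [Finset.HasAntidiagonal.mem_antidiagonal] at hq
      rw [← zcoeff_natCast k q.1, ← zcoeff_natCast k q.2]
      rcases lt_or_gt_of_ne hne with h1 | h1
      · rw [hf _ h1, zero_mul]
      · rw [hg _ (by lia), mul_zero]
    -- For negative m or n the right side is zero by the convention on `zcoeff`, and the pair (m, n)
    -- does not occur in the antidiagonal, so the left side vanishes too.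
    rcases lt_or_ge m 0 with hm | hm
    · rw [zcoeff_neg k hm, zero_mul]
      exact Finset.sum_eq_zero fun q hq => key q hq (by lia)
    rcases lt_or_ge n 0 with hn | hn
    · rw [zcoeff_neg k hn, mul_zero]
      refine Finset.sum_eq_zero fun q hq => key q hq ?_
      rw [Finset.HasAntidiagonal.mem_antidiagonal] at hq
      lia
    lift m to ℕ using hm
    lift n to ℕ using hn
    rw [Finset.sum_eq_single (m, n), zcoeff_natCast, zcoeff_natCast]
    · rintro ⟨a, b⟩ hq hne
      refine key _ hq fun h1 => hne ?_
      rw [Finset.HasAntidiagonal.mem_antidiagonal] at hq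
      ext <;> simp at hq h1 ⊢ <;> lia
    · intro h1
      exact absurd (Finset.HasAntidiagonal.mem_antidiagonal.2 (by lia)) h1

theorem zcoeff_one (n : ℤ) : zcoeff k n (1 : PowerSeries R) = if n = 0 then 1 else 0 := by
  rcases lt_or_ge n 0 with h | h
  · rw [zcoeff_neg k h, if_neg h.ne]
  · lift n to ℕ using h
    rw [zcoeff_natCast, PowerSeries.coeff_one]
    simp

variable (R) in
/-- The filtration of `R⟦T⟧` by the order in `T`. -/
def ordFil : AlgFiltration k (PowerSeries R) where
  F n := ⨅ (i : ℤ) (_ : i < n), LinearMap.ker (zcoeff k i)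
  anti m n h f hf := by
    simp only [Submodule.mem_iInf, LinearMap.mem_ker] at hf ⊢
    exact fun i hi => hf i (hi.trans_le h)
  one_mem := by
    simp only [Submodule.mem_iInf, LinearMap.mem_ker]
    exact fun i hi => zcoeff_neg k hi _
  mul_mem {m n f g} hf hg := by
    simp only [Submodule.mem_iInf, LinearMap.mem_ker] at hf hg ⊢
    intro i hi
    have h1 : ∀ j < n, zcoeff k j g = 0 := hg
    -- Since i is below the sum of the two orders, i - n is below the order of f; the coefficient at
    -- i is then a product whose first factor vanishes.
    have := zcoeff_mul k (m := i - n) (fun j hj => hf j (by lia)) h1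
    rw [sub_add_cancel] at this
    rw [this, hf _ (by lia), zero_mul]

theorem mem_ordFil {n : ℤ} {f : PowerSeries R} :
    f ∈ (ordFil k R).F n ↔ ∀ i < n, zcoeff k i f = 0 := by
  simp only [ordFil, Submodule.mem_iInf, LinearMap.mem_ker]

theorem mem_ordFil_of_nonpos {n : ℤ} (hn : n ≤ 0) (f : PowerSeries R) : f ∈ (ordFil k R).F n :=
  (mem_ordFil k).2 fun _ hi => zcoeff_neg k (hi.trans_le hn) f

/-- The leading coefficient, as a linear map on `gr_n R⟦T⟧`. -/
def leadCoeffPiece (n : ℤ) : GrPiece (ordFil k R) n →ₗ[k] R :=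
  Submodule.liftQ _ ((zcoeff k n).comp ((ordFil k R).F n).subtype) fun f hf =>
    (mem_ordFil k).1 (show (f : PowerSeries R) ∈ (ordFil k R).F (n + 1) from hf) n (by lia)

theorem leadCoeffPiece_mk (n : ℤ) (f : (ordFil k R).F n) :
    leadCoeffPiece k n (grMk (ordFil k R) n f) = zcoeff k n (f : PowerSeries R) := rfl

variable (R) in
/-- The algebra morphism `gr R⟦T⟧ → R` taking leading coefficients. -/
def leadCoeff : Gr (ordFil k R) →ₐ[k] R :=
  DirectSum.toAlgebra k (GrPiece (ordFil k R)) (leadCoeffPiece k)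
    (by rw [gOne_def, leadCoeffPiece_mk, zcoeff_one, if_pos rfl])
    (by
      intro m n x y
      obtain ⟨a, rfl⟩ := grMk_surjective _ m x
      obtain ⟨b, rfl⟩ := grMk_surjective _ n y
      exact zcoeff_mul k ((mem_ordFil k).1 a.2) ((mem_ordFil k).1 b.2))

theorem leadCoeff_grCls (n : ℤ) (f : PowerSeries R) (hf : f ∈ (ordFil k R).F n) :
    leadCoeff k R (grCls (ordFil k R) n f hf) = zcoeff k n f := by
  exact DirectSum.toAddMonoid_of (fun i => (leadCoeffPiece k (R := R) i).toAddMonoidHom) n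
    (grMk _ n ⟨f, hf⟩)

variable {k} {A : Type w} [Ring A] [Algebra k A]

/-- The algebra morphism `gr A → R` attached to a filtered morphism `μ : A → R⟦T⟧`: it maps
`[a]_n` to the coefficient of `T ^ n` in `μ a`. -/
def symbolMap (Φ : AlgFiltration k A) (μ : A →ₐ[k] PowerSeries R)
    (hμ : IsFiltered Φ (ordFil k R) μ) : Gr Φ →ₐ[k] R :=
  (leadCoeff k R).comp (grMap Φ (ordFil k R) μ hμ)

theorem symbolMap_grCls (Φ : AlgFiltration k A) (μ : A →ₐ[k] PowerSeries R)
    (hμ : IsFiltered Φ (ordFil k R) μ) (n : ℤ) (a : A) (ha : a ∈ Φ.F n) :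
    symbolMap Φ μ hμ (grCls Φ n a ha) = zcoeff k n (μ a) := by
  rw [symbolMap, AlgHom.comp_apply, grMap_grCls, leadCoeff_grCls]

end PowerSeries

/-! ## Algebra morphisms out of `k ⊕ V e` -/

section SubalgW

variable {k : Type u} {V : Type v} {A : Type w} [CommRing k] [Ring V] [Algebra k V]
  [Ring A] [Algebra k A]

/-- The algebra morphism `k ⊕ V e → A` obtained from an action of `V` on functions `ι → A` which
commutes with right multiplications and for which `e` acts by `f ↦ y * f o`. -/
def subalgWLift {ι : Type*} (e : V) (rep : V →ₐ[k] Module.End k (ι → A)) (y : ι → A) (o : ι)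
    (hrep : ∀ (v : V) (f : ι → A) (a : A), rep v (fun i => f i * a) = fun i => rep v f i * a)
    (he : ∀ f : ι → A, rep e f = fun i => y i * f o) : subalgW k e →ₐ[k] A :=
  -- For x = c + a e, the function e f = y f(o) is a right multiple of y, and a commutes with right
  -- multiplications; so the value of x f at o depends on f only through a right factor f(o). Taking
  -- f = x' 1 makes the evaluation multiplicative.
  have key : ∀ (x : subalgW k e) (f : ι → A), rep x f o = rep x 1 o * f o := by
    rintro ⟨_, c, a, rfl⟩ f
    have h : ∀ g : ι → A, rep (algebraMap k V c + a * e) g o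
        = (algebraMap k A c + rep a y o) * g o := by
      intro g
      rw [map_add, AlgHom.commutes, map_mul, LinearMap.add_apply, Module.End.mul_apply, he, hrep,
        Module.algebraMap_end_apply, Pi.add_apply, Pi.smul_apply, add_mul, Algebra.smul_def]
    rw [h, h 1, Pi.one_apply, mul_one]
  AlgHom.ofLinearMap
    { toFun := fun x => rep x 1 o
      map_add' := fun x y => by simp
      map_smul' := fun c x => by simp }
    (by simp)
    (fun x x' => by
      change rep (x * x' : V) 1 o = rep x 1 o * rep x' 1 o
      rw [map_mul, Module.End.mul_apply, key])

/-- The subalgebra of the elements `u` such that `N u ⊆ N`. -/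
def rightStab (N : Submodule k V) : Subalgebra k V where
  carrier := {u | ∀ v ∈ N, v * u ∈ N}
  mul_mem' {a b} ha hb v hv := by
    rw [← mul_assoc]
    exact hb _ (ha v hv)
  add_mem' {a b} ha hb v hv := by
    rw [mul_add]
    exact N.add_mem (ha v hv) (hb v hv)
  algebraMap_mem' c v hv := by
    rw [← Algebra.commutes, ← Algebra.smul_def]
    exact N.smul_mem c hv

/-- The submodule of the elements `v` such that `v s_i e ∈ T` for all `i`. -/
def colonFamily {ι : Type*} (T : Submodule k V) (s : ι → V) (e : V) : Submodule k V where
  carrier := {v | ∀ i, v * s i * e ∈ T}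
  add_mem' ha hb i := by
    rw [add_mul, add_mul]
    exact T.add_mem (ha i) (hb i)
  zero_mem' i := by
    rw [zero_mul, zero_mul]
    exact T.zero_mem
  smul_mem' c v hv i := by
    rw [smul_mul_assoc, smul_mul_assoc]
    exact T.smul_mem c (hv i)

/-- A subalgebra `T` of `k ⊕ V e` is everything as soon as it contains the `s_i e`, where `1` is
one of the `s_i`, and right multiplication by `V` preserves `{v | ∀ i, v s_i e ∈ T}`. -/
theorem subalgW_le {ι : Type*} (e : V) (T : Subalgebra k V) (s : ι → V) (o : ι) (ho : s o = 1)
    (hs : ∀ i, s i * e ∈ T) (h : rightStab (colonFamily T.toSubmodule s e) = ⊤) :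
    subalgW k e ≤ T := by
  rintro _ ⟨c, a, rfl⟩
  refine T.add_mem (T.algebraMap_mem c) ?_
  -- The colon submodule contains 1 and is stable under right multiplication by a, hence contains a;
  -- the index o then gives a e ∈ T.
  have ha : a ∈ rightStab (colonFamily T.toSubmodule s e) := h ▸ Algebra.mem_top
  have h1 : (1 : V) ∈ colonFamily T.toSubmodule s e := fun i => by
    rw [one_mul]
    exact hs i
  have := ha 1 h1 o
  rwa [one_mul, ho, mul_one] at this

theorem subalgW_algHom_ext (e : V) {f g : subalgW k e →ₐ[k] A}
    (h : subalgW k e ≤ (AlgHom.equalizer f g).map (subalgW k e).val) : f = g := by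
  ext x
  obtain ⟨y, hy, hyx⟩ := h x.2
  rwa [Subtype.ext (a1 := y) (a2 := x) hyx] at hy

end SubalgW

/-! ## Algebra morphisms out of `V^B` and `W^B` -/

section BettiLift

variable (k : Type u) [CommRing k] {A : Type v} [Ring A] [Algebra k A]

theorem Xpow_add (i : Fin 2) (m n : ℤ) : Xpow k i (m + n) = Xpow k i m * Xpow k i n := by
  rw [Xpow, Xpow, Xpow, ← map_mul, zpow_add]

theorem Xpow_zero (i : Fin 2) : Xpow k i 0 = 1 := by rw [Xpow, zpow_zero, map_one]

theorem Xpow_one (i : Fin 2) : Xpow k i 1 = X k i := by rw [Xpow, zpow_one, X]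

theorem X_mul_Xpow_neg_one (i : Fin 2) : X k i * Xpow k i (-1) = 1 := by
  rw [← Xpow_one, ← Xpow_add, add_neg_cancel, Xpow_zero]

theorem Xpow_neg_one_mul_X (i : Fin 2) : Xpow k i (-1) * X k i = 1 := by
  rw [← Xpow_one, ← Xpow_add, neg_add_cancel, Xpow_zero]

theorem of_inv_eq_Xpow (i : Fin 2) :
    MonoidAlgebra.of k (FreeGroup (Fin 2)) (FreeGroup.of i)⁻¹ = Xpow k i (-1) := by
  rw [Xpow, zpow_neg_one]

theorem subalgebra_VB_eq_top (S : Subalgebra k (VB k)) (h : ∀ i, X k i ∈ S)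
    (h' : ∀ i, Xpow k i (-1) ∈ S) : S = ⊤ := by
  refine eq_top_iff.2 fun x _ => ?_
  induction x using MonoidAlgebra.induction_on with
  | of g =>
    induction g using FreeGroup.induction_on with
    | C1 => rw [map_one]; exact S.one_mem
    | of i => exact h i
    | inv_of i _ => exact of_inv_eq_Xpow k i ▸ h' i
    | mul a b ha hb => rw [map_mul]; exact S.mul_mem (ha trivial) (hb trivial)
  | add a b ha hb => exact S.add_mem (ha trivial) (hb trivial)
  | smul r a ha => exact S.smul_mem (ha trivial) r

/-- The algebra morphism `V^B → A` mapping the generators to given units. -/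
def liftVB (x : Fin 2 → Aˣ) : VB k →ₐ[k] A :=
  MonoidAlgebra.lift k A (FreeGroup (Fin 2)) ((Units.coeHom A).comp (FreeGroup.lift x))

theorem liftVB_of (x : Fin 2 → Aˣ) (g : FreeGroup (Fin 2)) :
    liftVB k x (MonoidAlgebra.of k _ g) = (FreeGroup.lift x g : Aˣ) := by
  rw [liftVB, MonoidAlgebra.lift_of]
  rfl

theorem liftVB_X (x : Fin 2 → Aˣ) (i : Fin 2) : liftVB k x (X k i) = x i := by
  rw [X, liftVB_of, FreeGroup.lift_apply_of]

theorem liftVB_Xpow (x : Fin 2 → Aˣ) (i : Fin 2) (n : ℤ) :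
    liftVB k x (Xpow k i n) = (x i ^ n : Aˣ) := by
  rw [Xpow, liftVB_of, map_zpow, FreeGroup.lift_apply_of]

theorem X1inv_mul (k : Type u) [CommRing k] : X1inv k * (1 + yB k 0) = 1 := by
  refine Subtype.ext ?_
  change Xpow k 1 (-1) * (1 + Xpow k 0 0 * (X k 1 - 1)) = 1
  rw [Xpow_zero, one_mul, add_sub_cancel, Xpow_neg_one_mul_X]

theorem mul_X1inv (k : Type u) [CommRing k] : (1 + yB k 0) * X1inv k = 1 := by
  refine Subtype.ext ?_
  change (1 + Xpow k 0 0 * (X k 1 - 1)) * Xpow k 1 (-1) = 1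
  rw [Xpow_zero, one_mul, add_sub_cancel, X_mul_Xpow_neg_one]

/-- The elements X_0^n (X_1 - 1) and X_1⁻¹ generate W^B. In the criterion `subalgW_le`, right
multiplication by X_0^{±1} shifts n, and right multiplication by X_1^{±1} is handled by rewriting it
through v (X_1 - 1). -/
theorem algHom_WB_ext {f g : WB k →ₐ[k] A} (h1 : f (X1inv k) = g (X1inv k))
    (h : ∀ n, f (yB k n) = g (yB k n)) : f = g := by
  refine subalgW_algHom_ext (X k 1 - 1) ?_
  set T := (AlgHom.equalizer f g).map (WB k).val with hT
  have hinv : Xpow k 1 (-1) ∈ T := ⟨X1inv k, h1, rfl⟩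
  have hy : ∀ n, Xpow k 0 n * (X k 1 - 1) ∈ T := fun n => ⟨yB k n, h n, rfl⟩
  refine subalgW_le (X k 1 - 1) T (Xpow k 0) 0 (Xpow_zero k 0) hy (subalgebra_VB_eq_top k _ ?_ ?_)
  · intro i v hv n
    fin_cases i
    · have := hv (1 + n)
      rw [Xpow_add, Xpow_one, ← mul_assoc] at this
      exact this
    · have h0 := hv 0
      rw [Xpow_zero, mul_one] at h0
      -- With ε = X_1 - 1: v X_1 X_0^n ε = (v ε)(X_0^n ε) + v X_0^n ε.
      have := T.add_mem (T.mul_mem h0 (hy n)) (hv n)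
      convert! this using 1
      simp only [Fin.mk_one]
      noncomm_ring
  · intro i v hv n
    fin_cases i
    · have := hv (-1 + n)
      rw [Xpow_add, ← mul_assoc] at this
      exact this
    · have h0 := hv 0
      rw [Xpow_zero, mul_one] at h0
      -- With ε = X_1 - 1: v X_1⁻¹ X_0^n ε = v X_0^n ε - (v ε) X_1⁻¹ (X_0^n ε). This is the only
      -- place where the generator X_1⁻¹ enters.
      have := T.sub_mem (hv n) (T.mul_mem (T.mul_mem h0 hinv) (hy n))
      convert! this using 1
      have e : v * (X k 1 - 1) * Xpow k 1 (-1) = v - v * Xpow k 1 (-1) := by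
        rw [mul_sub, mul_one, sub_mul, mul_assoc, X_mul_Xpow_neg_one, mul_one]
      rw [e]
      simp only [Fin.mk_one]
      noncomm_ring

/-- The shift `f ↦ (n ↦ f (n + 1))` of functions on `ℤ`. -/
def shiftUnit (A : Type v) [Ring A] [Algebra k A] : (Module.End k (ℤ → A))ˣ where
  val := LinearMap.funLeft k A (fun n => n + 1)
  inv := LinearMap.funLeft k A (fun n => n - 1)
  val_inv := by ext f n; simp [LinearMap.funLeft_apply]
  inv_val := by ext f n; simp [LinearMap.funLeft_apply]

/-- The automorphism `f ↦ f + y f(0)` of functions on `ℤ`. -/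
def transvectionUnit (y : ℤ → A) (c : Aˣ) (hc : (c : A) = 1 + y 0) :
    (Module.End k (ℤ → A))ˣ where
  val :=
    { toFun := fun f n => f n + y n * f 0
      map_add' := fun f g => by ext n; simp only [Pi.add_apply, mul_add]; abel
      map_smul' := fun r f => by ext n; simp }
  -- If g = f + y f(0), then g(0) = c f(0), so f(0) = c⁻¹ g(0) and f is recovered from g.
  inv :=
    { toFun := fun f n => f n - y n * (c⁻¹ : Aˣ) * f 0
      map_add' := fun f g => by ext n; simp only [Pi.add_apply, mul_add]; abel
      map_smul' := fun r f => by ext n; simp [smul_sub] }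
  val_inv := by
    refine LinearMap.ext fun f => funext fun n => ?_
    change f n - y n * (c⁻¹ : Aˣ) * f 0 + y n * (f 0 - y 0 * (c⁻¹ : Aˣ) * f 0) = f n
    have h : y 0 = c - 1 := by rw [hc, add_sub_cancel_left]
    rw [h, sub_mul, Units.mul_inv]
    noncomm_ring
  inv_val := by
    refine LinearMap.ext fun f => funext fun n => ?_
    change f n + y n * f 0 - y n * (c⁻¹ : Aˣ) * (f 0 + y 0 * f 0) = f n
    have h : f 0 + y 0 * f 0 = c * f 0 := by rw [hc, add_mul, one_mul]
    rw [h, mul_assoc, Units.inv_mul_cancel_left, add_sub_cancel_right]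

/-- The action of `V^B` on functions `ℤ → A` where `X_0` acts by `f ↦ (n ↦ f (n + 1))` and `X_1`
acts by `f ↦ f + y f(0)`. -/
def repVB (y : ℤ → A) (c : Aˣ) (hc : (c : A) = 1 + y 0) : VB k →ₐ[k] Module.End k (ℤ → A) :=
  -- The model is f(n) = X_0^n v: replacing v by X_0 v shifts n, and replacing it by X_1 v adds
  -- X_0^n (X_1 - 1) v, which is y n * f 0.
  liftVB k ![shiftUnit k A, transvectionUnit k y c hc]

section

variable (y : ℤ → A) (c : Aˣ) (hc : (c : A) = 1 + y 0)

theorem repVB_X_zero (f : ℤ → A) (n : ℤ) : repVB k y c hc (X k 0) f n = f (n + 1) := by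
  rw [repVB, liftVB_X]
  rfl

theorem repVB_X_zero_inv (f : ℤ → A) (n : ℤ) :
    repVB k y c hc (Xpow k 0 (-1)) f n = f (n - 1) := by
  rw [repVB, liftVB_Xpow, zpow_neg_one]
  rfl

theorem repVB_X_one (f : ℤ → A) (n : ℤ) :
    repVB k y c hc (X k 1) f n = f n + y n * f 0 := by
  rw [repVB, liftVB_X]
  rfl

theorem repVB_X_one_inv (f : ℤ → A) (n : ℤ) :
    repVB k y c hc (Xpow k 1 (-1)) f n = f n - y n * (c⁻¹ : Aˣ) * f 0 := by
  rw [repVB, liftVB_Xpow, zpow_neg_one]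
  rfl

theorem repVB_Xpow_zero (f : ℤ → A) (m n : ℤ) :
    repVB k y c hc (Xpow k 0 m) f n = f (n + m) := by
  induction m using Int.induction_on generalizing n with
  | zero => rw [Xpow_zero, map_one, add_zero]; rfl
  | succ i ih =>
    rw [add_comm, Xpow_add, Xpow_one, map_mul, Module.End.mul_apply, repVB_X_zero, ih]
    ring_nf
  | pred i ih =>
    rw [sub_eq_neg_add, Xpow_add, map_mul, Module.End.mul_apply, repVB_X_zero_inv, ih]
    ring_nf

/-- The generators and their inverses act by shifts and left multiplications, so they centralize
right multiplication by a; a centralizer is a subalgebra. -/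
theorem repVB_mul_right (v : VB k) (f : ℤ → A) (a : A) :
    repVB k y c hc v (fun i => f i * a) = fun i => repVB k y c hc v f i * a := by
  let R : Module.End k (ℤ → A) :=
    { toFun := fun f i => f i * a
      map_add' := fun f g => by ext n; simp [add_mul]
      map_smul' := fun r f => by ext n; simp }
  have h : (Subalgebra.centralizer k {R}).comap (repVB k y c hc) = ⊤ := by
    refine subalgebra_VB_eq_top k _ (fun i => ?_) (fun i => ?_) <;>
      rw [Subalgebra.mem_comap, Subalgebra.mem_centralizer_iff] <;>
      rintro _ rfl <;>
      refine LinearMap.ext fun f => funext fun n => ?_ <;>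
      fin_cases i
    · exact (congrArg (· * a) (repVB_X_zero k y c hc f n)).trans
        (repVB_X_zero k y c hc (R f) n).symm
    · refine (congrArg (· * a) (repVB_X_one k y c hc f n)).trans
        (Eq.trans ?_ (repVB_X_one k y c hc (R f) n).symm)
      change (f n + y n * f 0) * a = f n * a + y n * (f 0 * a)
      rw [add_mul, mul_assoc]
    · exact (congrArg (· * a) (repVB_X_zero_inv k y c hc f n)).trans
        (repVB_X_zero_inv k y c hc (R f) n).symm
    · refine (congrArg (· * a) (repVB_X_one_inv k y c hc f n)).trans
        (Eq.trans ?_ (repVB_X_one_inv k y c hc (R f) n).symm)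
      change (f n - y n * (c⁻¹ : Aˣ) * f 0) * a = f n * a - y n * (c⁻¹ : Aˣ) * (f 0 * a)
      rw [sub_mul, mul_assoc _ _ a]
  have hv : v ∈ (Subalgebra.centralizer k {R}).comap (repVB k y c hc) := h ▸ Algebra.mem_top
  rw [Subalgebra.mem_comap, Subalgebra.mem_centralizer_iff] at hv
  exact (LinearMap.congr_fun (hv R rfl) f).symm

theorem repVB_X_one_sub_one (f : ℤ → A) :
    repVB k y c hc (X k 1 - 1) f = fun i => y i * f 0 := by
  ext n
  rw [map_sub, map_one, LinearMap.sub_apply, Pi.sub_apply, repVB_X_one, Module.End.one_apply,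
    add_sub_cancel_left]

/-- The algebra morphism `W^B → A` mapping `X_0^n (X_1 - 1)` to `y n`. -/
def liftWB : WB k →ₐ[k] A :=
  subalgWLift (X k 1 - 1) (repVB k y c hc) y 0 (repVB_mul_right k y c hc)
    (repVB_X_one_sub_one k y c hc)

theorem liftWB_apply (x : WB k) : liftWB k y c hc x = repVB k y c hc x 1 0 := rfl

theorem liftWB_mul (a : VB k) :
    liftWB k y c hc ⟨a * (X k 1 - 1), mul_mem_subalgW k _ _⟩ = repVB k y c hc a y 0 := by
  rw [liftWB_apply, map_mul, Module.End.mul_apply, repVB_X_one_sub_one]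
  simp

theorem liftWB_yB (n : ℤ) : liftWB k y c hc (yB k n) = y n := by
  rw [yB, liftWB_mul, repVB_Xpow_zero, zero_add]

end

end BettiLift

/-! ## Algebra morphisms out of `V^DR` and `W^DR` -/

section DeRhamLift

variable (k : Type u) [CommRing k] {A : Type v} [Ring A] [Algebra k A]

theorem universalEnvelopingEquivFreeAlgebra_e (i : Fin 2) :
    FreeLieAlgebra.universalEnvelopingEquivFreeAlgebra k (Fin 2) (e k i) = FreeAlgebra.ι k i := by
  have h : (FreeLieAlgebra.universalEnvelopingEquivFreeAlgebra k (Fin 2)).symm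
      (FreeAlgebra.ι k i) = e k i := by
    rw [FreeLieAlgebra.universalEnvelopingEquivFreeAlgebra_symm_apply, FreeAlgebra.lift_ι_apply]
    rfl
  rw [← h, AlgEquiv.apply_symm_apply]

/-- The algebra morphism `V^DR → A` mapping the generators to given elements. -/
def liftVDR (x : Fin 2 → A) : VDR k →ₐ[k] A :=
  (FreeAlgebra.lift k x).comp
    (FreeLieAlgebra.universalEnvelopingEquivFreeAlgebra k (Fin 2)).toAlgHom

theorem liftVDR_e (x : Fin 2 → A) (i : Fin 2) : liftVDR k x (e k i) = x i := by
  refine (congrArg (FreeAlgebra.lift k x) (universalEnvelopingEquivFreeAlgebra_e k i)).trans ?_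
  rw [FreeAlgebra.lift_ι_apply]

theorem algHom_VDR_ext {f g : VDR k →ₐ[k] A} (h : ∀ i, f (e k i) = g (e k i)) : f = g := by
  have : f.comp (FreeLieAlgebra.universalEnvelopingEquivFreeAlgebra k (Fin 2)).symm.toAlgHom
      = g.comp (FreeLieAlgebra.universalEnvelopingEquivFreeAlgebra k (Fin 2)).symm.toAlgHom := by
    refine FreeAlgebra.hom_ext (funext fun i => ?_)
    have hi : (FreeLieAlgebra.universalEnvelopingEquivFreeAlgebra k (Fin 2)).symm
        (FreeAlgebra.ι k i) = e k i := by
      rw [← universalEnvelopingEquivFreeAlgebra_e, AlgEquiv.symm_apply_apply]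
    exact (congrArg f hi).trans ((h i).trans (congrArg g hi).symm)
  refine AlgHom.ext fun x => ?_
  have hx := DFunLike.congr_fun this
    (FreeLieAlgebra.universalEnvelopingEquivFreeAlgebra k (Fin 2) x)
  have hs := AlgEquiv.symm_apply_apply
    (FreeLieAlgebra.universalEnvelopingEquivFreeAlgebra k (Fin 2)) x
  exact (congrArg f hs).symm.trans (hx.trans (congrArg g hs))

theorem subalgebra_VDR_eq_top (S : Subalgebra k (VDR k)) (h : ∀ i, e k i ∈ S) : S = ⊤ := by
  have : S.val.comp (liftVDR k fun i => (⟨e k i, h i⟩ : S)) = AlgHom.id k (VDR k) :=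
    algHom_VDR_ext k fun i => by rw [AlgHom.comp_apply, liftVDR_e]; rfl
  refine eq_top_iff.2 fun x _ => ?_
  have hx := DFunLike.congr_fun this x
  rw [AlgHom.id_apply] at hx
  rw [← hx]
  exact Subtype.property _

/-- The e_0^n e_1 generate W^DR: right multiplication by e_0 raises n, and v e_1 e_0^n e_1 = (v
e_1)(e_0^n e_1). -/
theorem algHom_WDR_ext {f g : WDR k →ₐ[k] A} (h : ∀ n, f (yDR k n) = g (yDR k n)) : f = g := by
  refine subalgW_algHom_ext (e k 1) ?_
  set T := (AlgHom.equalizer f g).map (WDR k).val with hT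
  have hy : ∀ n, e k 0 ^ n * e k 1 ∈ T := fun n => ⟨yDR k n, h n, rfl⟩
  refine subalgW_le (e k 1) T (fun n : ℕ => e k 0 ^ n) 0 (pow_zero _) hy
    (subalgebra_VDR_eq_top k _ fun i v hv n => ?_)
  fin_cases i
  · have : v * e k 0 ^ (n + 1) * e k 1 ∈ T := hv (n + 1)
    rw [pow_succ', ← mul_assoc] at this
    exact this
  · have h0 : v * e k 0 ^ 0 * e k 1 ∈ T := hv 0
    rw [pow_zero, mul_one] at h0
    have := T.mul_mem h0 (hy n)
    rw [← mul_assoc] at this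
    exact this

/-- The action of `V^DR` on functions `ℕ → A` where `e_0` acts by `f ↦ (n ↦ f (n + 1))` and `e_1`
acts by `f ↦ y f(0)`. -/
def repVDR (y : ℕ → A) : VDR k →ₐ[k] Module.End k (ℕ → A) :=
  liftVDR k ![LinearMap.funLeft k A (fun n => n + 1),
    { toFun := fun f n => y n * f 0
      map_add' := fun f g => by ext n; simp [mul_add]
      map_smul' := fun r f => by ext n; simp }]

variable (y : ℕ → A)

theorem repVDR_e_zero (f : ℕ → A) (n : ℕ) : repVDR k y (e k 0) f n = f (n + 1) := by
  rw [repVDR, liftVDR_e]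
  rfl

theorem repVDR_e_one (f : ℕ → A) : repVDR k y (e k 1) f = fun n => y n * f 0 := by
  rw [repVDR, liftVDR_e]
  rfl

theorem repVDR_e_zero_pow (f : ℕ → A) (m n : ℕ) :
    repVDR k y (e k 0 ^ m) f n = f (n + m) := by
  induction m generalizing n with
  | zero => rw [pow_zero, map_one]; rfl
  | succ m ih =>
    rw [pow_succ', map_mul, Module.End.mul_apply, repVDR_e_zero, ih]
    ring_nf

theorem repVDR_mul_right (v : VDR k) (f : ℕ → A) (a : A) :
    repVDR k y v (fun i => f i * a) = fun i => repVDR k y v f i * a := by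
  let R : Module.End k (ℕ → A) :=
    { toFun := fun f i => f i * a
      map_add' := fun f g => by ext n; simp [add_mul]
      map_smul' := fun r f => by ext n; simp }
  have h : (Subalgebra.centralizer k {R}).comap (repVDR k y) = ⊤ := by
    refine subalgebra_VDR_eq_top k _ fun i => ?_
    rw [Subalgebra.mem_comap, Subalgebra.mem_centralizer_iff]
    rintro _ rfl
    refine LinearMap.ext fun f => funext fun n => ?_
    fin_cases i
    · exact (congrArg (· * a) (repVDR_e_zero k y f n)).trans (repVDR_e_zero k y (R f) n).symm
    · refine (congrArg (fun g => g n * a) (repVDR_e_one k y f)).trans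
        (Eq.trans ?_ (congrFun (repVDR_e_one k y (R f)) n).symm)
      exact mul_assoc _ _ _
  have hv : v ∈ (Subalgebra.centralizer k {R}).comap (repVDR k y) := h ▸ Algebra.mem_top
  rw [Subalgebra.mem_comap, Subalgebra.mem_centralizer_iff] at hv
  exact (LinearMap.congr_fun (hv R rfl) f).symm

/-- The algebra morphism `W^DR → A` mapping `e_0^n e_1` to `y n`. -/
def liftWDR : WDR k →ₐ[k] A :=
  subalgWLift (e k 1) (repVDR k y) y 0 (repVDR_mul_right k y) (repVDR_e_one k y)

theorem liftWDR_yDR (n : ℕ) : liftWDR k y (yDR k n) = y n := by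
  change repVDR k y (e k 0 ^ n * e k 1) 1 0 = y n
  rw [map_mul, Module.End.mul_apply, repVDR_e_one,
    repVDR_e_zero_pow, zero_add, Pi.one_apply, mul_one]

end DeRhamLift

/-! ## Leading coefficients and subalgebras, tensor products -/

section SymbolConstructions

variable {k : Type u} [CommRing k]

section

variable {A : Type v} [Ring A] [Algebra k A]

/-- The elements of `F^n A` whose class in `gr A` belongs to `S`. -/
def clsPreimage (Φ : AlgFiltration k A) (n : ℤ) (S : Submodule k (Gr Φ)) : Submodule k A :=
  (S.comap ((DirectSum.lof k ℤ (GrPiece Φ) n).comp (grMk Φ n))).map (Φ.F n).subtype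

theorem mem_clsPreimage (Φ : AlgFiltration k A) {n : ℤ} {S : Submodule k (Gr Φ)} {a : A} :
    a ∈ clsPreimage Φ n S ↔ ∃ ha : a ∈ Φ.F n, grCls Φ n a ha ∈ S := by
  constructor
  · rintro ⟨x, hx, rfl⟩
    exact ⟨x.2, hx⟩
  · rintro ⟨ha, h⟩
    exact ⟨⟨a, ha⟩, h, rfl⟩

/-- Turns a statement on gr A into an inclusion of submodules of A, which can be checked on spans,
products and suprema describing F^n. -/
theorem grDeg_le_of_le_clsPreimage (Φ : AlgFiltration k A) {n : ℤ} {S : Submodule k (Gr Φ)}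
    (h : Φ.F n ≤ clsPreimage Φ n S) : grDeg Φ n ≤ S := by
  intro x hx
  obtain ⟨a, ha, rfl⟩ := (mem_grDeg Φ).1 hx
  exact ((mem_clsPreimage Φ).1 (h ha)).2

theorem grDeg_mul_mem (Φ : AlgFiltration k A) {m n : ℤ} {x y : Gr Φ} (hx : x ∈ grDeg Φ m)
    (hy : y ∈ grDeg Φ n) : x * y ∈ grDeg Φ (m + n) := by
  obtain ⟨a, ha, rfl⟩ := (mem_grDeg Φ).1 hx
  obtain ⟨b, hb, rfl⟩ := (mem_grDeg Φ).1 hy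
  rw [grCls_mul]
  exact grCls_mem_grDeg Φ _

theorem grMap_mem_grDeg {B : Type w} [Ring B] [Algebra k B] (Φ : AlgFiltration k A)
    (Ψ : AlgFiltration k B) (f : A →ₐ[k] B) (hf : IsFiltered Φ Ψ f) {n : ℤ} {x : Gr Φ}
    (hx : x ∈ grDeg Φ n) : grMap Φ Ψ f hf x ∈ grDeg Ψ n := by
  obtain ⟨a, ha, rfl⟩ := (mem_grDeg Φ).1 hx
  rw [grMap_grCls]
  exact grCls_mem_grDeg Ψ _

end

/-! ### Coefficientwise maps of power series, and leading coefficients on tensor products. -/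

variable {R : Type v} [Ring R] [Algebra k R] {S : Type w} [Ring S] [Algebra k S]

/-- The action of an algebra morphism on the coefficients of power series. -/
def seriesMap (f : R →ₐ[k] S) : PowerSeries R →ₐ[k] PowerSeries S :=
  { PowerSeries.map (f : R →+* S) with
    commutes' := fun c => by
      change PowerSeries.map (f : R →+* S) (algebraMap k (PowerSeries R) c) = _
      rw [PowerSeries.algebraMap_apply, PowerSeries.algebraMap_apply, PowerSeries.map_C]
      exact congrArg _ (f.commutes c) }

theorem coeff_seriesMap (f : R →ₐ[k] S) (n : ℕ) (p : PowerSeries R) :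
    PowerSeries.coeff n (seriesMap f p) = f (PowerSeries.coeff n p) :=
  PowerSeries.coeff_map (f : R →+* S) n p

theorem zcoeff_seriesMap (f : R →ₐ[k] S) (n : ℤ) (p : PowerSeries R) :
    zcoeff k n (seriesMap f p) = f (zcoeff k n p) := by
  rcases lt_or_ge n 0 with h | h
  · rw [zcoeff_neg k h, zcoeff_neg k h, map_zero]
  · lift n to ℕ using h
    rw [zcoeff_natCast, zcoeff_natCast, coeff_seriesMap]

theorem seriesMap_mem_ordFil (f : R →ₐ[k] S) {n : ℤ} {p : PowerSeries R}
    (hp : p ∈ (ordFil k R).F n) : seriesMap f p ∈ (ordFil k S).F n := by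
  rw [mem_ordFil] at hp ⊢
  intro i hi
  rw [zcoeff_seriesMap, hp i hi, map_zero]

theorem commute_seriesMap_includeLeft_includeRight (p : PowerSeries R) (q : PowerSeries S) :
    Commute (seriesMap (Algebra.TensorProduct.includeLeft : R →ₐ[k] R ⊗[k] S) p)
      (seriesMap (Algebra.TensorProduct.includeRight : S →ₐ[k] R ⊗[k] S) q) := by
  refine PowerSeries.ext fun n => ?_
  rw [PowerSeries.coeff_mul, PowerSeries.coeff_mul, ← Finset.Nat.sum_antidiagonal_swap]
  refine Finset.sum_congr rfl fun i _ => ?_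
  simp only [coeff_seriesMap, Prod.fst_swap, Prod.snd_swap,
    Algebra.TensorProduct.includeLeft_apply, Algebra.TensorProduct.includeRight_apply,
    Algebra.TensorProduct.tmul_mul_tmul, one_mul, mul_one]

variable {A : Type*} [Ring A] [Algebra k A] {B : Type*} [Ring B] [Algebra k B]

/-- Restriction of the codomain of an algebra morphism to the power series whose coefficients lie
in a subalgebra. -/
def seriesCodRestrict (μ : A →ₐ[k] PowerSeries R) (T : Subalgebra k R)
    (h : ∀ a n, PowerSeries.coeff n (μ a) ∈ T) : A →ₐ[k] PowerSeries T :=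
  -- A series over T is determined by its image over R, so all the morphism axioms can be checked
  -- after applying `seriesMap T.val`.
  have key : ∀ {a : A} {p : PowerSeries T}, seriesMap T.val p = μ a →
      PowerSeries.mk (fun n => (⟨PowerSeries.coeff n (μ a), h a n⟩ : T)) = p := by
    intro a p hp
    ext n
    rw [PowerSeries.coeff_mk]
    exact (congrArg (PowerSeries.coeff n) hp).symm.trans (coeff_seriesMap T.val n p)
  have key' : ∀ a : A, seriesMap T.val
      (PowerSeries.mk (fun n => (⟨PowerSeries.coeff n (μ a), h a n⟩ : T))) = μ a := by
    intro a
    ext n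
    rw [coeff_seriesMap, PowerSeries.coeff_mk]
    rfl
  { toFun := fun a => PowerSeries.mk fun n => ⟨PowerSeries.coeff n (μ a), h a n⟩
    map_one' := key (by rw [map_one, map_one])
    map_mul' := fun a b => key (by rw [map_mul, map_mul, key', key'])
    map_zero' := key (by rw [map_zero, map_zero])
    map_add' := fun a b => key (by rw [map_add, map_add, key', key'])
    commutes' := fun c => key (by rw [AlgHom.commutes, AlgHom.commutes]) }

theorem seriesMap_seriesCodRestrict (μ : A →ₐ[k] PowerSeries R) (T : Subalgebra k R)
    (h : ∀ a n, PowerSeries.coeff n (μ a) ∈ T) (a : A) :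
    seriesMap T.val (seriesCodRestrict μ T h a) = μ a := by
  ext n
  rw [coeff_seriesMap]
  exact congrArg T.val (PowerSeries.coeff_mk n _)

/-- The morphism `A ⊗ B → (R ⊗ S)⟦T⟧`, `a ⊗ b ↦ μ a ⊗ ν b`. -/
def seriesTensor (μ : A →ₐ[k] PowerSeries R) (ν : B →ₐ[k] PowerSeries S) :
    A ⊗[k] B →ₐ[k] PowerSeries (R ⊗[k] S) :=
  Algebra.TensorProduct.lift
    ((seriesMap (Algebra.TensorProduct.includeLeft : R →ₐ[k] R ⊗[k] S)).comp μ)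
    ((seriesMap (Algebra.TensorProduct.includeRight : S →ₐ[k] R ⊗[k] S)).comp ν)
    (fun _ _ => commute_seriesMap_includeLeft_includeRight _ _)

theorem seriesTensor_tmul (μ : A →ₐ[k] PowerSeries R) (ν : B →ₐ[k] PowerSeries S) (a : A) (b : B) :
    seriesTensor μ ν (a ⊗ₜ b)
      = seriesMap (Algebra.TensorProduct.includeLeft : R →ₐ[k] R ⊗[k] S) (μ a)
        * seriesMap (Algebra.TensorProduct.includeRight : S →ₐ[k] R ⊗[k] S) (ν b) :=
  Algebra.TensorProduct.lift_tmul _ _ _ _ _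

variable {Φ : AlgFiltration k A} {Ψ : AlgFiltration k B} {μ : A →ₐ[k] PowerSeries R}
  {ν : B →ₐ[k] PowerSeries S}

theorem tmul_mem_tensor {m n : ℤ} {a : A} {b : B} (ha : a ∈ Φ.F m) (hb : b ∈ Ψ.F n) :
    a ⊗ₜ[k] b ∈ (Φ.tensor Ψ).F (m + n) :=
  tmul_mem_tensorFamily rfl ha hb

theorem isFiltered_seriesTensor (hμ : IsFiltered Φ (ordFil k R) μ)
    (hν : IsFiltered Ψ (ordFil k S) ν) :
    IsFiltered (Φ.tensor Ψ) (ordFil k (R ⊗[k] S)) (seriesTensor μ ν) := by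
  intro n
  change (tensorFamily Φ.F Ψ.F n)
    ≤ ((ordFil k (R ⊗[k] S)).F n).comap (seriesTensor μ ν).toLinearMap
  refine tensorFamily_le fun i j hij a ha b hb => ?_
  change seriesTensor μ ν (a ⊗ₜ b) ∈ (ordFil k (R ⊗[k] S)).F n
  rw [seriesTensor_tmul, ← hij]
  exact (ordFil k (R ⊗[k] S)).mul_mem (seriesMap_mem_ordFil _ (hμ i a ha))
    (seriesMap_mem_ordFil _ (hν j b hb))

theorem zcoeff_seriesTensor (hμ : IsFiltered Φ (ordFil k R) μ)
    (hν : IsFiltered Ψ (ordFil k S) ν) {m n : ℤ} {a : A} {b : B} (ha : a ∈ Φ.F m)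
    (hb : b ∈ Ψ.F n) :
    zcoeff k (m + n) (seriesTensor μ ν (a ⊗ₜ b)) = zcoeff k m (μ a) ⊗ₜ zcoeff k n (ν b) := by
  rw [seriesTensor_tmul, zcoeff_mul k
    ((mem_ordFil k).1 (seriesMap_mem_ordFil _ (hμ m a ha)))
    ((mem_ordFil k).1 (seriesMap_mem_ordFil _ (hν n b hb))), zcoeff_seriesMap, zcoeff_seriesMap,
    Algebra.TensorProduct.includeLeft_apply, Algebra.TensorProduct.includeRight_apply,
    Algebra.TensorProduct.tmul_mul_tmul, one_mul, mul_one]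

theorem isFiltered_includeLeft (h1 : (1 : B) ∈ Ψ.F 0) :
    IsFiltered Φ (Φ.tensor Ψ) (Algebra.TensorProduct.includeLeft : A →ₐ[k] A ⊗[k] B) :=
  fun n _ ha => tmul_mem_tensorFamily (add_zero n) ha h1

theorem isFiltered_includeRight (h1 : (1 : A) ∈ Φ.F 0) :
    IsFiltered Ψ (Φ.tensor Ψ) (Algebra.TensorProduct.includeRight : B →ₐ[k] A ⊗[k] B) :=
  fun n _ hb => tmul_mem_tensorFamily (zero_add n) h1 hb

theorem commute_grMap_includeLeft_includeRight (x : Gr Φ) (y : Gr Ψ) :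
    Commute (grMap Φ (Φ.tensor Ψ) _ (isFiltered_includeLeft Ψ.one_mem) x)
      (grMap Ψ (Φ.tensor Ψ) _ (isFiltered_includeRight Φ.one_mem) y) := by
  induction x using DirectSum.induction_on with
  | zero => rw [map_zero]; exact Commute.zero_left _
  | add x x' hx hx' => rw [map_add]; exact hx.add_left hx'
  | of m x =>
    obtain ⟨a, rfl⟩ := grMk_surjective Φ m x
    induction y using DirectSum.induction_on with
    | zero => rw [map_zero]; exact Commute.zero_right _
    | add y y' hy hy' => rw [map_add]; exact hy.add_right hy'
    | of n y =>
      obtain ⟨b, rfl⟩ := grMk_surjective Ψ n y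
      change Commute (grMap Φ (Φ.tensor Ψ) _ (isFiltered_includeLeft Ψ.one_mem) (grCls Φ m a a.2))
        (grMap Ψ (Φ.tensor Ψ) _ (isFiltered_includeRight Φ.one_mem) (grCls Ψ n b b.2))
      rw [commute_iff_eq, grMap_grCls, grMap_grCls, grCls_mul, grCls_mul]
      exact grCls_congr _ (add_comm m n) (by simp) _

variable (Φ Ψ) in
/-- The algebra morphism `gr A ⊗ gr B → gr (A ⊗ B)`. -/
def grTensor : Gr Φ ⊗[k] Gr Ψ →ₐ[k] Gr (Φ.tensor Ψ) :=
  Algebra.TensorProduct.lift (grMap Φ (Φ.tensor Ψ) _ (isFiltered_includeLeft Ψ.one_mem))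
    (grMap Ψ (Φ.tensor Ψ) _ (isFiltered_includeRight Φ.one_mem))
    commute_grMap_includeLeft_includeRight

theorem grTensor_tmul_grCls {m n : ℤ} {a : A} {b : B} (ha : a ∈ Φ.F m) (hb : b ∈ Ψ.F n) :
    grTensor Φ Ψ (grCls Φ m a ha ⊗ₜ grCls Ψ n b hb)
      = grCls (Φ.tensor Ψ) (m + n) (a ⊗ₜ b) (tmul_mem_tensor ha hb) := by
  rw [grTensor, Algebra.TensorProduct.lift_tmul, grMap_grCls, grMap_grCls, grCls_mul]
  exact grCls_congr _ rfl (by simp) _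

theorem tensor_F_le_clsPreimage {S : Submodule k (Gr (Φ.tensor Ψ))} {n : ℤ}
    (h : ∀ (i j : ℤ) (_ : i + j = n) (a : A) (ha : a ∈ Φ.F i) (b : B) (hb : b ∈ Ψ.F j),
      grCls (Φ.tensor Ψ) (i + j) (a ⊗ₜ b) (tmul_mem_tensor ha hb) ∈ S) :
    (Φ.tensor Ψ).F n ≤ clsPreimage (Φ.tensor Ψ) n S := by
  refine tensorFamily_le fun i j hij a ha b hb => ?_
  subst hij
  exact (mem_clsPreimage _).2 ⟨_, h i j rfl a ha b hb⟩

theorem eq_top_of_grCls_tmul_mem {S : Submodule k (Gr (Φ.tensor Ψ))}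
    (h : ∀ (i j : ℤ) (a : A) (ha : a ∈ Φ.F i) (b : B) (hb : b ∈ Ψ.F j),
      grCls (Φ.tensor Ψ) (i + j) (a ⊗ₜ b) (tmul_mem_tensor ha hb) ∈ S) : S = ⊤ :=
  eq_top_of_grCls_mem _ _ fun _ _ ha => ((mem_clsPreimage _).1
    (tensor_F_le_clsPreimage (fun i j _ a ha b hb => h i j a ha b hb) ha)).2

theorem symbolMap_grCls_tmul (hμ : IsFiltered Φ (ordFil k R) μ) (hν : IsFiltered Ψ (ordFil k S) ν)
    {m n : ℤ} {a : A} {b : B} (ha : a ∈ Φ.F m) (hb : b ∈ Ψ.F n) :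
    symbolMap (Φ.tensor Ψ) (seriesTensor μ ν) (isFiltered_seriesTensor hμ hν)
      (grCls (Φ.tensor Ψ) (m + n) (a ⊗ₜ b) (tmul_mem_tensor ha hb))
        = symbolMap Φ μ hμ (grCls Φ m a ha) ⊗ₜ symbolMap Ψ ν hν (grCls Ψ n b hb) := by
  rw [symbolMap_grCls, symbolMap_grCls, symbolMap_grCls, zcoeff_seriesTensor hμ hν ha hb]

/-- Shows that the symbol map inverts `grTensor` on one side once both factors are isomorphisms,
without any exactness of the tensor product. -/
theorem symbolMap_comp_grTensor (hμ : IsFiltered Φ (ordFil k R) μ)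
    (hν : IsFiltered Ψ (ordFil k S) ν) :
    (symbolMap (Φ.tensor Ψ) (seriesTensor μ ν) (isFiltered_seriesTensor hμ hν)).comp
      (grTensor Φ Ψ) = Algebra.TensorProduct.map (symbolMap Φ μ hμ) (symbolMap Ψ ν hν) := by
  refine Algebra.TensorProduct.ext ?_ ?_
  · refine grAlgHom_ext Φ fun n a ha => ?_
    simp only [AlgHom.comp_apply, Algebra.TensorProduct.includeLeft_apply,
      Algebra.TensorProduct.map_tmul]
    rw [← grCls_one Ψ, grTensor_tmul_grCls, symbolMap_grCls_tmul]
  · refine grAlgHom_ext Ψ fun n a ha => ?_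
    simp only [AlgHom.comp_apply, AlgHom.restrictScalars_apply,
      Algebra.TensorProduct.includeRight_apply, Algebra.TensorProduct.map_tmul]
    rw [← grCls_one Φ, grTensor_tmul_grCls, symbolMap_grCls_tmul]

/-- If leading coefficients identify `gr A` with `R` and `gr B` with `S`, they identify
`gr (A ⊗ B)` with `R ⊗ S`. -/
def symbolTensorEquiv (hμ : IsFiltered Φ (ordFil k R) μ) (hν : IsFiltered Ψ (ordFil k S) ν)
    (α : Gr Φ ≃ₐ[k] R) (β : Gr Ψ ≃ₐ[k] S) (hα : α.toAlgHom = symbolMap Φ μ hμ)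
    (hβ : β.toAlgHom = symbolMap Ψ ν hν) : Gr (Φ.tensor Ψ) ≃ₐ[k] R ⊗[k] S :=
  AlgEquiv.ofAlgHom
    (symbolMap (Φ.tensor Ψ) (seriesTensor μ ν) (isFiltered_seriesTensor hμ hν))
    ((grTensor Φ Ψ).comp (Algebra.TensorProduct.congr α β).symm.toAlgHom)
    (by
      rw [← AlgHom.comp_assoc, symbolMap_comp_grTensor hμ hν, ← hα, ← hβ]
      exact AlgHom.ext fun z => (Algebra.TensorProduct.congr α β).apply_symm_apply z)
    (by
      -- The other composite need only be tested on the classes [a ⊗ b], which span gr(A ⊗ B) and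
      -- come from `grTensor`.
      have : LinearMap.eqLocus (((grTensor Φ Ψ).comp
          (Algebra.TensorProduct.congr α β).symm.toAlgHom).comp (symbolMap (Φ.tensor Ψ)
            (seriesTensor μ ν) (isFiltered_seriesTensor hμ hν))).toLinearMap
          LinearMap.id = ⊤ := by
        refine eq_top_of_grCls_tmul_mem fun i j a ha b hb => ?_
        rw [LinearMap.mem_eqLocus, AlgHom.toLinearMap_apply, AlgHom.comp_apply,
          symbolMap_grCls_tmul hμ hν ha hb, ← hα, ← hβ, ← grTensor_tmul_grCls]
        exact congrArg (grTensor Φ Ψ)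
          ((Algebra.TensorProduct.congr α β).symm_apply_apply (_ ⊗ₜ _))
      refine AlgHom.ext fun x => ?_
      exact (LinearMap.mem_eqLocus).1 (this.ge (Submodule.mem_top (x := x))))

end SymbolConstructions

/-! ## The isomorphism `gr(V^B) ≃ V^DR` -/

section Comparison

variable (k : Type u) [CommRing k]

/-- The power series `1 + e_i T`, as a unit. -/
def magnusUnit (i : Fin 2) : (PowerSeries (VDR k))ˣ :=
  IsUnit.unit (a := 1 + PowerSeries.monomial 1 (e k i)) (by
    have h : PowerSeries.constantCoeff (1 + PowerSeries.monomial 1 (e k i)) = 1 := by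
      rw [map_add, map_one, ← PowerSeries.coeff_zero_eq_constantCoeff_apply,
        PowerSeries.coeff_monomial, if_neg zero_ne_one, add_zero]
    exact MvPowerSeries.isUnit_iff_constantCoeff.2 (h ▸ isUnit_one))

/-- The Magnus expansion `V^B → V^DR⟦T⟧`, `X_i ↦ 1 + e_i T`. -/
def magnus : VB k →ₐ[k] PowerSeries (VDR k) := liftVB k (magnusUnit k)

theorem magnus_X (i : Fin 2) : magnus k (X k i) = 1 + PowerSeries.monomial 1 (e k i) := by
  rw [magnus, liftVB_X]
  rfl

theorem magnus_X_sub_one (i : Fin 2) :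
    magnus k (X k i - 1) = PowerSeries.monomial 1 (e k i) := by
  rw [map_sub, map_one, magnus_X, add_sub_cancel_left]

/-- Setting T = 0 in the Magnus expansion gives the augmentation; hence I is sent to series of order
at least one. -/
theorem constantCoeff_magnus_of (g : FreeGroup (Fin 2)) :
    PowerSeries.constantCoeff (magnus k (MonoidAlgebra.of k _ g)) = 1 := by
  have hX : ∀ i, PowerSeries.constantCoeff (magnus k (X k i)) = 1 := fun i => by
    rw [magnus_X, map_add, map_one, ← PowerSeries.coeff_zero_eq_constantCoeff_apply,
      PowerSeries.coeff_monomial, if_neg zero_ne_one, add_zero]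
  induction g using FreeGroup.induction_on with
  | C1 => rw [map_one, map_one, map_one]
  | of i => exact hX i
  | inv_of i _ =>
    have h := congrArg (fun v => PowerSeries.constantCoeff (magnus k v)) (Xpow_neg_one_mul_X k i)
    rw [map_mul, map_mul, hX, mul_one, map_one, map_one] at h
    rw [of_inv_eq_Xpow, h]
  | mul a b ha hb => rw [map_mul, map_mul, map_mul, ha, hb, one_mul]

theorem filVB_F_of_nonpos {n : ℤ} (hn : n ≤ 0) : (filVB k).F n = ⊤ := augPow_nonpos k _ hn

theorem filVB_F_succ (n : ℕ) :
    (filVB k).F ((n : ℤ) + 1) = augIdeal k (FreeGroup (Fin 2)) ^ (n + 1) := augPow_succ k _ n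

theorem filVB_F_one : (filVB k).F 1 = augIdeal k (FreeGroup (Fin 2)) := by
  have := filVB_F_succ k 0
  rwa [Nat.cast_zero, zero_add, zero_add, pow_one] at this

theorem filVB_F_succ_succ (n : ℕ) :
    (filVB k).F ((n : ℤ) + 1 + 1) = (filVB k).F ((n : ℤ) + 1) * (filVB k).F 1 := by
  have := filVB_F_succ k (n + 1)
  push_cast at this
  rw [this, filVB_F_succ, filVB_F_one, pow_succ _ (n + 1)]

/-- To check that a morphism from `V^B` is filtered, it suffices to look at the elements `g - 1`. -/
theorem filVB_F_induction {B : Type v} [Ring B] [Algebra k B] (Ψ : AlgFiltration k B)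
    (f : VB k →ₐ[k] B) (h0 : ∀ x, f x ∈ Ψ.F 0)
    (h : ∀ g, f (MonoidAlgebra.of k _ g - 1) ∈ Ψ.F 1) : IsFiltered (filVB k) Ψ f := by
  intro n
  rcases le_or_gt n 0 with hn | hn
  · exact fun x _ => Ψ.anti hn (h0 x)
  obtain ⟨m, rfl⟩ : ∃ m : ℕ, n = (m : ℤ) + 1 := ⟨(n - 1).toNat, by lia⟩
  have h1 : (filVB k).F 1 ≤ (Ψ.F 1).comap f.toLinearMap := by
    rw [filVB_F_one]
    refine Submodule.span_le.2 ?_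
    rintro _ ⟨g, rfl⟩
    exact h g
  change (filVB k).F _ ≤ (Ψ.F _).comap f.toLinearMap
  induction m with
  | zero => simpa using h1
  | succ m ih =>
    push_cast
    rw [filVB_F_succ_succ, Submodule.mul_le]
    intro a ha b hb
    change f (a * b) ∈ Ψ.F _
    rw [map_mul]
    exact Ψ.mul_mem (ih (by lia) ha) (h1 hb)

theorem isFiltered_magnus : IsFiltered (filVB k) (ordFil k (VDR k)) (magnus k) := by
  refine filVB_F_induction k _ _ (fun _ => mem_ordFil_of_nonpos k le_rfl _) fun g => ?_
  rw [mem_ordFil]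
  intro i hi
  rcases lt_or_ge i 0 with h | h
  · exact zcoeff_neg k h _
  · obtain rfl : i = ((0 : ℕ) : ℤ) := by lia
    rw [zcoeff_natCast, PowerSeries.coeff_zero_eq_constantCoeff_apply, map_sub, map_sub, map_one,
      map_one, constantCoeff_magnus_of, sub_self]

/-- The algebra morphism `V^DR → gr(V^B)`, `e_i ↦ [X_i - 1]_1`. -/
def grGen : VDR k →ₐ[k] Gr (filVB k) :=
  liftVDR k fun i => grCls (filVB k) 1 (X k i - 1) (X_sub_one_mem k i)

theorem grGen_e (i : Fin 2) :
    grGen k (e k i) = grCls (filVB k) 1 (X k i - 1) (X_sub_one_mem k i) := by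
  rw [grGen, liftVDR_e]

theorem degVDR_natCast (n : ℕ) :
    degVDR k n = Submodule.span k (Set.range (e k)) ^ n := by
  rw [degVDR, if_pos (by lia), Int.toNat_natCast]

theorem degVDR_zero : degVDR k 0 = 1 := by
  have := degVDR_natCast k 0
  rwa [Nat.cast_zero, pow_zero] at this

theorem degVDR_one : degVDR k 1 = Submodule.span k (Set.range (e k)) := by
  have := degVDR_natCast k 1
  rwa [Nat.cast_one, pow_one] at this

theorem degVDR_succ (n : ℕ) : degVDR k ((n : ℤ) + 1) = degVDR k n * degVDR k 1 := by
  have := degVDR_natCast k (n + 1)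
  push_cast at this
  rw [this, degVDR_natCast, degVDR_one, pow_succ]

theorem map_grGen_degVDR_le (n : ℤ) :
    (degVDR k n).map (grGen k).toLinearMap ≤ grDeg (filVB k) n := by
  rcases lt_or_ge n 0 with h | h
  · rw [degVDR, if_neg (not_le.2 h), Submodule.map_bot]
    exact bot_le
  lift n to ℕ using h
  rw [Submodule.map_le_iff_le_comap]
  have h1 : degVDR k 1 ≤ (grDeg (filVB k) 1).comap (grGen k).toLinearMap := by
    rw [degVDR_one, Submodule.span_le]
    rintro _ ⟨i, rfl⟩
    change grGen k (e k i) ∈ grDeg (filVB k) 1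
    rw [grGen_e]
    exact grCls_mem_grDeg _ _
  induction n with
  | zero =>
    rw [Nat.cast_zero, degVDR_zero, Submodule.one_le]
    change grGen k 1 ∈ grDeg (filVB k) 0
    rw [map_one, ← grCls_one]
    exact grCls_mem_grDeg _ _
  | succ n ih =>
    push_cast
    rw [degVDR_succ, Submodule.mul_le]
    intro a ha b hb
    change grGen k (a * b) ∈ grDeg (filVB k) (n + 1)
    rw [map_mul]
    exact grDeg_mul_mem _ (ih ha) (h1 hb)

theorem of_sub_one_mem (g : FreeGroup (Fin 2)) :
    MonoidAlgebra.of k _ g - 1 ∈ (filVB k).F 1 := by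
  rw [filVB_F_one]
  exact Submodule.subset_span ⟨g, rfl⟩

/-- The identity gh - 1 = (g - 1)(h - 1) + (g - 1) + (h - 1) has its product term in I², so g ↦ [g -
1]_1 is a homomorphism to an additive group. -/
theorem grCls_of_mul_sub_one (g h : FreeGroup (Fin 2)) :
    grCls (filVB k) 1 (MonoidAlgebra.of k _ (g * h) - 1) (of_sub_one_mem k _)
      = grCls (filVB k) 1 (MonoidAlgebra.of k _ g - 1) (of_sub_one_mem k _)
        + grCls (filVB k) 1 (MonoidAlgebra.of k _ h - 1) (of_sub_one_mem k _) := by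
  have h2 := (filVB k).mul_mem (of_sub_one_mem k g) (of_sub_one_mem k h)
  have h1 := (filVB k).anti (show (1 : ℤ) ≤ 1 + 1 by lia) h2
  -- The zero being inserted is the degree-one class of (g - 1)(h - 1).
  rw [← add_zero (grCls (filVB k) 1 (MonoidAlgebra.of k _ h - 1) _),
    ← grCls_eq_zero (filVB k) 1 h1 h2, ← grCls_add, ← grCls_add]
  refine grCls_congr _ rfl ?_ _
  rw [map_mul]
  noncomm_ring

theorem grCls_of_sub_one_mem (g : FreeGroup (Fin 2)) :
    grCls (filVB k) 1 (MonoidAlgebra.of k _ g - 1) (of_sub_one_mem k g)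
      ∈ (degVDR k 1).map (grGen k).toLinearMap := by
  have hX : ∀ i, grCls (filVB k) 1 (MonoidAlgebra.of k _ (FreeGroup.of i) - 1)
      (of_sub_one_mem k _) ∈ (degVDR k 1).map (grGen k).toLinearMap := fun i => by
    rw [degVDR_one]
    exact ⟨e k i, Submodule.subset_span ⟨i, rfl⟩, grGen_e k i⟩
  have h1 : grCls (filVB k) 1 (MonoidAlgebra.of k _ 1 - 1) (of_sub_one_mem k _) = 0 := by
    refine grCls_eq_zero _ _ _ ?_
    rw [map_one, sub_self]
    exact Submodule.zero_mem _
  induction g using FreeGroup.induction_on with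
  | C1 => rw [h1]; exact Submodule.zero_mem _
  | of i => exact hX i
  | inv_of i _ =>
    have h := grCls_of_mul_sub_one k (FreeGroup.of i)⁻¹ (FreeGroup.of i)
    rw [grCls_congr (filVB k) rfl (by rw [inv_mul_cancel] :
      MonoidAlgebra.of k _ ((FreeGroup.of i)⁻¹ * FreeGroup.of i) - 1
        = MonoidAlgebra.of k (FreeGroup (Fin 2)) 1 - 1), h1] at h
    rw [eq_neg_of_add_eq_zero_left h.symm]
    exact Submodule.neg_mem _ (hX i)
  | mul a b ha hb => rw [grCls_of_mul_sub_one]; exact Submodule.add_mem _ ha hb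

/-- Generation in degree one: I^n is spanned by products of n elements g - 1, and each [g - 1]_1 is
a combination of the [X_i - 1]_1. -/
theorem grDeg_le_map_grGen (n : ℤ) :
    grDeg (filVB k) n ≤ (degVDR k n).map (grGen k).toLinearMap := by
  rcases lt_or_ge n 0 with h | h
  · rw [grDeg_eq_bot]
    · exact bot_le
    · rw [filVB_F_of_nonpos k (show n + 1 ≤ 0 by lia)]
      exact le_top
  lift n to ℕ using h
  refine grDeg_le_of_le_clsPreimage _ ?_
  have h1 : (filVB k).F 1 ≤ clsPreimage (filVB k) 1 ((degVDR k 1).map (grGen k).toLinearMap) := by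
    conv_lhs => rw [filVB_F_one]
    refine Submodule.span_le.2 ?_
    rintro _ ⟨g, rfl⟩
    exact (mem_clsPreimage _).2 ⟨of_sub_one_mem k g, grCls_of_sub_one_mem k g⟩
  rcases n with _ | n
  · have h0 : ∀ x, x ∈ (filVB k).F 0 := fun x => by
      rw [filVB_F_of_nonpos k le_rfl]
      exact Submodule.mem_top
    intro x _
    rw [Nat.cast_zero]
    induction x using MonoidAlgebra.induction_on with
    | of g =>
      refine (mem_clsPreimage _).2 ⟨h0 _, ?_⟩
      -- In degree zero every group element has class 1, since g - 1 ∈ F^1.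
      have hg : grCls (filVB k) 0 (MonoidAlgebra.of k _ g - 1) (h0 _) = 0 :=
        grCls_eq_zero _ _ _ (of_sub_one_mem k g)
      have hs := grCls_add (filVB k) 0 (h0 (MonoidAlgebra.of k _ g - 1)) (filVB k).one_mem
      rw [hg, zero_add, grCls_one] at hs
      rw [← grCls_congr (filVB k) rfl (sub_add_cancel (MonoidAlgebra.of k _ g) 1) (h0 _), hs,
        degVDR_zero]
      exact ⟨1, Submodule.one_le.1 le_rfl, map_one (grGen k)⟩
    | add a b ha hb => exact Submodule.add_mem _ (ha (h0 a)) (hb (h0 b))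
    | smul r a ha => exact Submodule.smul_mem _ r (ha (h0 a))
  · push_cast
    induction n with
    | zero => simpa using h1
    | succ n ih =>
      push_cast
      rw [filVB_F_succ_succ, Submodule.mul_le]
      intro a ha b hb
      obtain ⟨ha', x, hx, hxa⟩ := (mem_clsPreimage _).1 (ih ha)
      obtain ⟨hb', y, hy, hyb⟩ := (mem_clsPreimage _).1 (h1 hb)
      refine (mem_clsPreimage _).2 ⟨(filVB k).mul_mem ha' hb', x * y, ?_, ?_⟩
      · have := degVDR_succ k (n + 1)
        push_cast at this
        rw [this]
        exact Submodule.mul_mem_mul hx hy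
      · rw [← grCls_mul (filVB k) ha' hb', ← hxa, ← hyb]
        exact map_mul (grGen k) x y

theorem map_grGen_degVDR (n : ℤ) :
    (degVDR k n).map (grGen k).toLinearMap = grDeg (filVB k) n :=
  (map_grGen_degVDR_le k n).antisymm (grDeg_le_map_grGen k n)

theorem grGen_surjective : Function.Surjective (grGen k) := by
  have h : LinearMap.range (grGen k).toLinearMap = ⊤ := by
    refine eq_top_of_grCls_mem _ _ fun n a ha => ?_
    obtain ⟨x, -, hx⟩ := grDeg_le_map_grGen k n (grCls_mem_grDeg _ ha)
    exact ⟨x, hx⟩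
  exact LinearMap.range_eq_top.1 h

/-- The leading coefficient of the Magnus expansion, `gr(V^B) → V^DR`. -/
def grMagnus : Gr (filVB k) →ₐ[k] VDR k := symbolMap (filVB k) (magnus k) (isFiltered_magnus k)

theorem zcoeff_magnus_X_sub_one (i : Fin 2) : zcoeff k 1 (magnus k (X k i - 1)) = e k i := by
  rw [magnus_X_sub_one, ← Nat.cast_one, zcoeff_natCast, PowerSeries.coeff_monomial_same]

/-- Makes `grGen` injective; with `grGen_surjective` this gives the isomorphism. -/
theorem grMagnus_comp_grGen : (grMagnus k).comp (grGen k) = AlgHom.id k (VDR k) := by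
  refine algHom_VDR_ext k fun i => ?_
  rw [AlgHom.comp_apply, grGen_e, grMagnus, symbolMap_grCls, zcoeff_magnus_X_sub_one,
    AlgHom.id_apply]

/-- The graded isomorphism `gr(V^B) ≃ V^DR`. -/
def isoV : Gr (filVB k) ≃ₐ[k] VDR k :=
  AlgEquiv.ofAlgHom (grMagnus k) (grGen k) (grMagnus_comp_grGen k) (by
    refine AlgHom.ext fun x => ?_
    obtain ⟨y, rfl⟩ := grGen_surjective k x
    exact congrArg (grGen k) (DFunLike.congr_fun (grMagnus_comp_grGen k) y))

theorem isoV_grGen (x : VDR k) : isoV k (grGen k x) = x :=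
  DFunLike.congr_fun (grMagnus_comp_grGen k) x

theorem isoV_grCls (n : ℤ) (a : VB k) (ha : a ∈ (filVB k).F n) :
    isoV k (grCls (filVB k) n a ha) = zcoeff k n (magnus k a) :=
  symbolMap_grCls _ _ _ n a ha

theorem isGrIsoV_isoV : IsGrIsoV (isoV k) := by
  constructor
  · intro n
    rw [← map_grGen_degVDR, ← Submodule.map_comp]
    have : (isoV k).toLinearMap.comp (grGen k).toLinearMap = LinearMap.id :=
      LinearMap.ext (isoV_grGen k)
    exact (congrArg (fun f => (degVDR k n).map f) this).trans (Submodule.map_id _)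
  · intro i
    rw [isoV_grCls, zcoeff_magnus_X_sub_one]

theorem isGrIsoV_iff (φ : Gr (filVB k) ≃ₐ[k] VDR k) : IsGrIsoV φ ↔ φ = isoV k := by
  constructor
  · intro h
    have key : φ.toAlgHom.comp (grGen k) = AlgHom.id k (VDR k) :=
      algHom_VDR_ext k fun i => (congrArg φ (grGen_e k i)).trans (h.2 i)
    refine AlgEquiv.ext fun x => ?_
    obtain ⟨y, rfl⟩ := grGen_surjective k x
    rw [isoV_grGen]
    exact DFunLike.congr_fun key y
  · rintro rfl
    exact isGrIsoV_isoV k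

theorem isoV_mem_degVDR {n : ℤ} {x : Gr (filVB k)} :
    isoV k x ∈ degVDR k n ↔ x ∈ grDeg (filVB k) n := by
  rw [← (isGrIsoV_isoV k).1 n]
  constructor
  · rintro ⟨y, hy, hxy⟩
    rwa [← (isoV k).injective hxy]
  · exact fun h => ⟨x, h, rfl⟩

/-! ## The isomorphism `gr(W^B) ≃ W^DR` -/

/-- The expansion of c + a (X_1 - 1) is c plus the expansion of a times e_1 T, so each coefficient
is a scalar plus a left multiple of e_1. -/
theorem coeff_magnus_mem_WDR (w : WB k) (n : ℕ) :
    PowerSeries.coeff n (magnus k w) ∈ WDR k := by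
  obtain ⟨_, c, a, rfl⟩ := w
  rw [map_add, map_mul, magnus_X_sub_one, AlgHom.commutes, map_add, PowerSeries.algebraMap_apply,
    PowerSeries.coeff_C]
  refine (WDR k).add_mem ?_ ?_
  · split_ifs
    · exact (WDR k).algebraMap_mem c
    · exact (WDR k).zero_mem
  · rw [PowerSeries.coeff_mul]
    refine (WDR k).sum_mem fun i _ => ?_
    rw [PowerSeries.coeff_monomial]
    split_ifs
    · exact mul_mem_subalgW k _ _
    · rw [mul_zero]
      exact (WDR k).zero_mem

/-- The Magnus expansion `W^B → W^DR⟦T⟧`. -/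
def magnusW : WB k →ₐ[k] PowerSeries (WDR k) :=
  seriesCodRestrict ((magnus k).comp (WB k).val) (WDR k) (coeff_magnus_mem_WDR k)

theorem coe_zcoeff_magnusW (n : ℤ) (w : WB k) :
    ((zcoeff k n (magnusW k w) : WDR k) : VDR k) = zcoeff k n (magnus k w) := by
  have h := zcoeff_seriesMap (WDR k).val n (magnusW k w)
  have h' := seriesMap_seriesCodRestrict ((magnus k).comp (WB k).val) (WDR k)
    (coeff_magnus_mem_WDR k) w
  exact h.symm.trans (congrArg (zcoeff k n) h')

theorem isFiltered_magnusW : IsFiltered (filWB k) (ordFil k (WDR k)) (magnusW k) := by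
  intro n w hw
  rw [mem_ordFil]
  intro i hi
  refine Subtype.ext ?_
  rw [coe_zcoeff_magnusW]
  exact (mem_ordFil k).1 (isFiltered_magnus k n w hw) i hi

/-- The leading coefficient of the Magnus expansion, `gr(W^B) → W^DR`. -/
def grMagnusW : Gr (filWB k) →ₐ[k] WDR k :=
  symbolMap (filWB k) (magnusW k) (isFiltered_magnusW k)

theorem grMagnusW_grCls (n : ℤ) (w : WB k) (hw : w ∈ (filWB k).F n) :
    grMagnusW k (grCls (filWB k) n w hw) = zcoeff k n (magnusW k w) :=
  symbolMap_grCls _ _ _ n w hw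

/-- The morphism `gr(W^B) → gr(V^B)` induced by the inclusion. -/
def grIncl : Gr (filWB k) →ₐ[k] Gr (filVB k) :=
  grMap (filWB k) (filVB k) (WB k).val (isFiltered_WB_val k)

theorem grIncl_grCls (n : ℤ) (w : WB k) (hw : w ∈ (filWB k).F n) :
    grIncl k (grCls (filWB k) n w hw) = grCls (filVB k) n w hw :=
  grMap_grCls _ _ _ _ n w hw

theorem grIncl_injective : Function.Injective (grIncl k) :=
  grMap_restrict_injective (filVB k) (WB k)

theorem coe_grMagnusW (x : Gr (filWB k)) :
    (grMagnusW k x : VDR k) = isoV k (grIncl k x) := by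
  have h : (WDR k).val.comp (grMagnusW k) = (isoV k).toAlgHom.comp (grIncl k) := by
    refine grAlgHom_ext _ fun n a ha => ?_
    have h1 := (congrArg (isoV k) (grIncl_grCls k n a ha)).trans (isoV_grCls k n a ha)
    rw [← coe_zcoeff_magnusW, ← grMagnusW_grCls k n a ha] at h1
    exact h1.symm
  exact DFunLike.congr_fun h x

/-- Injectivity is inherited from gr(V^B), in which gr(W^B) embeds. For surjectivity, [a]_n ∈
gr(V^B) multiplied by [X_1 - 1]_1 is the class of a (X_1 - 1) ∈ W^B, so all of V^DR e_1 is reached.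
-/
theorem grMagnusW_bijective : Function.Bijective (grMagnusW k) := by
  constructor
  · intro x y hxy
    refine grIncl_injective k ((isoV k).injective ?_)
    rw [← coe_grMagnusW, ← coe_grMagnusW, hxy]
  · have h : (⊤ : Submodule k (Gr (filVB k))) = (LinearMap.range ((WDR k).val.comp
        (grMagnusW k)).toLinearMap).comap
          ((LinearMap.mulRight k (e k 1)).comp (isoV k).toLinearMap) := by
      refine (eq_top_of_grCls_mem _ _ fun n a ha => ?_).symm
      have hw : (⟨a * (X k 1 - 1), mul_mem_subalgW k _ _⟩ : WB k) ∈ (filWB k).F (n + 1) :=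
        (filVB k).mul_mem ha (X_sub_one_mem k 1)
      refine ⟨grCls (filWB k) (n + 1) _ hw, ?_⟩
      change (grMagnusW k _ : VDR k) = isoV k (grCls (filVB k) n a ha) * e k 1
      rw [coe_grMagnusW, grIncl_grCls, ← (isGrIsoV_isoV k).2 1, ← map_mul, grCls_mul]
    rintro ⟨_, c, v, rfl⟩
    obtain ⟨y, hy⟩ := h.le (Submodule.mem_top (x := (isoV k).symm v))
    have hy' : (grMagnusW k y : VDR k) = v * e k 1 :=
      hy.trans (congrArg (· * e k 1) ((isoV k).apply_symm_apply v))
    refine ⟨algebraMap k _ c + y, Subtype.ext ?_⟩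
    rw [map_add, AlgHom.commutes]
    exact congrArg (algebraMap k (VDR k) c + ·) hy'

/-- The graded isomorphism `gr(W^B) ≃ W^DR`. -/
def isoW : Gr (filWB k) ≃ₐ[k] WDR k := AlgEquiv.ofBijective (grMagnusW k) (grMagnusW_bijective k)

theorem isoW_grCls (n : ℤ) (w : WB k) (hw : w ∈ (filWB k).F n) :
    isoW k (grCls (filWB k) n w hw) = zcoeff k n (magnusW k w) :=
  grMagnusW_grCls k n w hw

theorem coe_isoW (x : Gr (filWB k)) : (isoW k x : VDR k) = isoV k (grIncl k x) :=
  coe_grMagnusW k x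

theorem isoW_mem_degWDR {n : ℤ} {x : Gr (filWB k)} :
    isoW k x ∈ degWDR k n ↔ x ∈ grDeg (filWB k) n := by
  change (isoW k x : VDR k) ∈ degVDR k n ↔ _
  rw [coe_isoW, isoV_mem_degVDR]
  exact ⟨fun h => mem_grDeg_of_grMap_restrict (filVB k) (WB k) h,
    fun h => grMap_mem_grDeg _ _ _ _ h⟩

theorem map_isoW_grDeg (n : ℤ) :
    (grDeg (filWB k) n).map (isoW k).toLinearMap = degWDR k n := by
  ext x
  constructor
  · rintro ⟨y, hy, rfl⟩
    exact (isoW_mem_degWDR k).2 hy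
  · intro hx
    obtain ⟨y, rfl⟩ := (isoW k).surjective x
    exact ⟨y, (isoW_mem_degWDR k).1 hx, rfl⟩

theorem isGrIsoW_iff (ψ : Gr (filWB k) ≃ₐ[k] WDR k) : IsGrIsoW (isoV k) ψ ↔ ψ = isoW k := by
  constructor
  · intro h
    refine AlgEquiv.ext fun x => Subtype.ext ?_
    rw [coe_isoW]
    exact h.2 x
  · rintro rfl
    exact ⟨map_isoW_grDeg k, coe_isoW k⟩

/-! ## The isomorphism `gr(W^B ⊗ W^B) ≃ W^DR ⊗ W^DR` -/

/-- The Magnus expansion `W^B ⊗ W^B → (W^DR ⊗ W^DR)⟦T⟧`. -/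
def magnusWW : WB k ⊗[k] WB k →ₐ[k] PowerSeries (WDR k ⊗[k] WDR k) :=
  seriesTensor (magnusW k) (magnusW k)

theorem isFiltered_magnusWW :
    IsFiltered (filWWB k) (ordFil k (WDR k ⊗[k] WDR k)) (magnusWW k) :=
  isFiltered_seriesTensor (isFiltered_magnusW k) (isFiltered_magnusW k)

theorem zcoeff_magnusWW {m n : ℤ} {a b : WB k} (ha : a ∈ (filWB k).F m)
    (hb : b ∈ (filWB k).F n) :
    zcoeff k (m + n) (magnusWW k (a ⊗ₜ b))
      = zcoeff k m (magnusW k a) ⊗ₜ zcoeff k n (magnusW k b) :=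
  zcoeff_seriesTensor (isFiltered_magnusW k) (isFiltered_magnusW k) ha hb

/-- The graded isomorphism `gr(W^B ⊗ W^B) ≃ W^DR ⊗ W^DR`. -/
def isoWW : Gr (filWWB k) ≃ₐ[k] WDR k ⊗[k] WDR k :=
  symbolTensorEquiv (isFiltered_magnusW k) (isFiltered_magnusW k) (isoW k) (isoW k) rfl rfl

theorem isoWW_grCls (n : ℤ) (x : WB k ⊗[k] WB k) (hx : x ∈ (filWWB k).F n) :
    isoWW k (grCls (filWWB k) n x hx) = zcoeff k n (magnusWW k x) :=
  symbolMap_grCls _ _ (isFiltered_magnusWW k) n x hx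

theorem tmul_mem_filWWB {m n : ℤ} {a b : WB k} (ha : a ∈ (filWB k).F m)
    (hb : b ∈ (filWB k).F n) : a ⊗ₜ[k] b ∈ (filWWB k).F (m + n) :=
  tmul_mem_tensorFamily rfl ha hb

theorem isoWW_grCls_tmul {m n : ℤ} {a b : WB k} (ha : a ∈ (filWB k).F m)
    (hb : b ∈ (filWB k).F n) :
    isoWW k (grCls (filWWB k) (m + n) (a ⊗ₜ[k] b) (tmul_mem_filWWB k ha hb))
      = isoW k (grCls (filWB k) m a ha) ⊗ₜ[k] isoW k (grCls (filWB k) n b hb) := by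
  rw [isoWW_grCls, zcoeff_magnusWW k ha hb, isoW_grCls, isoW_grCls]

theorem map_isoWW_grDeg (n : ℤ) :
    (grDeg (filWWB k) n).map (isoWW k).toLinearMap = degWWDR k n := by
  refine le_antisymm ?_ ?_
  · rw [Submodule.map_le_iff_le_comap]
    refine grDeg_le_of_le_clsPreimage _ (tensor_F_le_clsPreimage ?_)
    rintro i j rfl a ha b hb
    change isoWW k (grCls (filWWB k) (i + j) (a ⊗ₜ b) (tmul_mem_filWWB k ha hb))
      ∈ degWWDR k (i + j)
    rw [isoWW_grCls_tmul k ha hb]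
    exact tmul_mem_tensorFamily rfl ((isoW_mem_degWDR k).2 (grCls_mem_grDeg _ _))
      ((isoW_mem_degWDR k).2 (grCls_mem_grDeg _ _))
  · refine tensorFamily_le ?_
    rintro i j rfl x hx y hy
    rw [← map_isoW_grDeg] at hx hy
    obtain ⟨x, hx, rfl⟩ := hx
    obtain ⟨y, hy, rfl⟩ := hy
    obtain ⟨a, ha, rfl⟩ := (mem_grDeg _).1 hx
    obtain ⟨b, hb, rfl⟩ := (mem_grDeg _).1 hy
    exact ⟨_, grCls_mem_grDeg _ (tmul_mem_filWWB k ha hb), isoWW_grCls_tmul k ha hb⟩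

theorem eq_top_of_grCls_tmul_mem_filWWB {S : Submodule k (Gr (filWWB k))}
    (h : ∀ (i j : ℤ) (a : WB k) (ha : a ∈ (filWB k).F i) (b : WB k) (hb : b ∈ (filWB k).F j),
      grCls (filWWB k) (i + j) (a ⊗ₜ[k] b) (tmul_mem_filWWB k ha hb) ∈ S) : S = ⊤ :=
  eq_top_of_grCls_tmul_mem h

theorem isGrIsoWW_iff (χ : Gr (filWWB k) ≃ₐ[k] WDR k ⊗[k] WDR k) :
    IsGrIsoWW (isoW k) χ ↔ χ = isoWW k := by
  constructor
  · intro h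
    have key : LinearMap.eqLocus χ.toLinearMap (isoWW k).toLinearMap = ⊤ := by
      refine eq_top_of_grCls_tmul_mem_filWWB k fun i j a ha b hb => ?_
      exact (h.2 i j a b ha hb).trans (isoWW_grCls_tmul k ha hb).symm
    exact AlgEquiv.ext fun x => key.ge (Submodule.mem_top (x := x))
  · rintro rfl
    exact ⟨map_isoWW_grDeg k, fun m n a b ha hb => isoWW_grCls_tmul k ha hb⟩

end Comparison

/-! ## Finite differences and filtrations -/

section Differences

variable {k : Type u} [CommRing k] {A : Type v} [Ring A] [Algebra k A] {B : Type w} [Ring B]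
  [Algebra k B]

variable (k A) in
/-- The difference operator `f ↦ (n ↦ f (n + 1) - f n)` on functions `ℤ → A`. -/
def diff : Module.End k (ℤ → A) where
  toFun f n := f (n + 1) - f n
  map_add' f g := by ext n; simp only [Pi.add_apply]; abel
  map_smul' c f := by ext n; simp [smul_sub]

theorem diff_apply (f : ℤ → A) (n : ℤ) : diff k A f n = f (n + 1) - f n := rfl

theorem diff_pow_succ_apply (m : ℕ) (f : ℤ → A) :
    (diff k A ^ (m + 1)) f = (diff k A ^ m) (diff k A f) := by
  rw [pow_succ, Module.End.mul_apply]

theorem diff_pow_succ_apply' (m : ℕ) (f : ℤ → A) :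
    (diff k A ^ (m + 1)) f = diff k A ((diff k A ^ m) f) := by
  rw [pow_succ', Module.End.mul_apply]

theorem diff_pow_linearMap (L : A →ₗ[k] B) (f : ℤ → A) (m : ℕ) (n : ℤ) :
    (diff k B ^ m) (fun i => L (f i)) n = L ((diff k A ^ m) f n) := by
  induction m generalizing n with
  | zero => rfl
  | succ m ih =>
    rw [diff_pow_succ_apply', diff_pow_succ_apply', diff_apply, diff_apply, ih, ih, map_sub]

theorem diff_pow_translate (f : ℤ → A) (c : ℤ) (m : ℕ) (n : ℤ) :
    (diff k A ^ m) (fun i => f (i + c)) n = (diff k A ^ m) f (n + c) := by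
  induction m generalizing n with
  | zero => rfl
  | succ m ih =>
    rw [diff_pow_succ_apply', diff_pow_succ_apply', diff_apply, diff_apply, ih, ih,
      add_right_comm]

/-- The functions `ℤ → A` whose `m`-th differences lie in `F^(p+m) A` for all `m`. -/
def diffFil (Φ : AlgFiltration k A) (p : ℤ) : Submodule k (ℤ → A) where
  carrier := {f | ∀ (m : ℕ) (n : ℤ), (diff k A ^ m) f n ∈ Φ.F (p + m)}
  add_mem' hf hg m n := by
    rw [map_add]
    exact (Φ.F _).add_mem (hf m n) (hg m n)
  zero_mem' m n := by
    rw [map_zero]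
    exact (Φ.F _).zero_mem
  smul_mem' c f hf m n := by
    rw [map_smul]
    exact (Φ.F _).smul_mem c (hf m n)

variable (Φ : AlgFiltration k A) (Ψ : AlgFiltration k B)

theorem apply_mem_of_mem_diffFil {Φ : AlgFiltration k A} {p : ℤ} {f : ℤ → A}
    (hf : f ∈ diffFil Φ p) (n : ℤ) : f n ∈ Φ.F p := by
  have := hf 0 n
  rwa [Nat.cast_zero, add_zero, pow_zero] at this

theorem diffFil_antitone : Antitone (diffFil Φ) :=
  fun _ _ h _ hf m n => Φ.anti (by lia) (hf m n)

theorem diff_mem_diffFil {Φ : AlgFiltration k A} {p : ℤ} {f : ℤ → A} (hf : f ∈ diffFil Φ p) :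
    diff k A f ∈ diffFil Φ (p + 1) := fun m n => by
  rw [← diff_pow_succ_apply]
  have := hf (m + 1) n
  rwa [Nat.cast_succ, add_comm (m : ℤ), ← add_assoc] at this

theorem translate_mem_diffFil {Φ : AlgFiltration k A} {p : ℤ} {f : ℤ → A}
    (hf : f ∈ diffFil Φ p) (c : ℤ) : (fun i => f (i + c)) ∈ diffFil Φ p := fun m n => by
  rw [diff_pow_translate]
  exact hf m _

theorem linearMap_mem_diffFil {Φ : AlgFiltration k A} {Ψ : AlgFiltration k B} {p q : ℤ}
    {f : ℤ → A} (hf : f ∈ diffFil Φ p) (L : A →ₗ[k] B)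
    (hL : ∀ n, ∀ a ∈ Φ.F n, L a ∈ Ψ.F (n + q)) : (fun i => L (f i)) ∈ diffFil Ψ (p + q) :=
  fun m n => by
    rw [diff_pow_linearMap, add_right_comm]
    exact hL _ _ (hf m n)

theorem mul_right_mem_diffFil {Φ : AlgFiltration k A} {p q : ℤ} {f : ℤ → A}
    (hf : f ∈ diffFil Φ p) {a : A} (ha : a ∈ Φ.F q) : (fun i => f i * a) ∈ diffFil Φ (p + q) :=
  linearMap_mem_diffFil hf (LinearMap.mulRight k a) fun _ _ hb => Φ.mul_mem hb ha

theorem one_mem_diffFil : (1 : ℤ → A) ∈ diffFil Φ 0 := by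
  rintro (_ | m) n
  · simpa using Φ.one_mem
  · have : diff k A 1 = 0 := by
      ext n
      rw [diff_apply, Pi.one_apply, Pi.one_apply, sub_self]
      rfl
    rw [diff_pow_succ_apply, this, map_zero]
    exact (Φ.F _).zero_mem

/-! ### Filteredness of the morphisms out of W^B. -/

/-- The filtration of the algebra of endomorphisms of the functions `ℤ → A`. -/
def endFil : AlgFiltration k (Module.End k (ℤ → A)) where
  F n := ⨅ p : ℤ, Submodule.compatibleMaps (diffFil Φ p) (diffFil Φ (p + n))
  anti m n h φ hφ := by
    rw [Submodule.mem_iInf] at hφ ⊢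
    exact fun p f hf => diffFil_antitone Φ (by lia) (hφ p hf)
  one_mem := by
    rw [Submodule.mem_iInf]
    intro p f hf
    rwa [Submodule.mem_comap, add_zero]
  mul_mem {m n φ χ} hφ hχ := by
    rw [Submodule.mem_iInf] at hφ hχ ⊢
    intro p f hf
    have := hφ _ (hχ p hf)
    rwa [Submodule.mem_comap, add_assoc, add_comm n] at this

theorem mem_endFil {n : ℤ} {φ : Module.End k (ℤ → A)} :
    φ ∈ (endFil Φ).F n ↔ ∀ p, ∀ f ∈ diffFil Φ p, φ f ∈ diffFil Φ (p + n) := by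
  simp only [endFil, Submodule.mem_iInf]
  rfl

theorem mul_sub_one_eq {R : Type v} [Ring R] (a b : R) :
    a * b - 1 = (a - 1) * (b - 1) + (a - 1) + (b - 1) := by
  noncomm_ring

/-- X_0 - 1 acts as the difference operator and X_1 - 1 as f ↦ y f(0) with y in `diffFil Φ 1`; both
raise the degree by one. Inverses are similar, and products follow from `mul_sub_one_eq`. -/
theorem repVB_of_sub_one_mem_endFil (y : ℤ → A) (c : Aˣ) (hc : (c : A) = 1 + y 0)
    (hy : y ∈ diffFil Φ 1) (hc' : ((c⁻¹ : Aˣ) : A) ∈ Φ.F 0)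
    (g : FreeGroup (Fin 2)) :
    repVB k y c hc (MonoidAlgebra.of k _ g - 1) ∈ (endFil Φ).F 1 := by
  rw [map_sub, map_one]
  induction g using FreeGroup.induction_on with
  | C1 =>
    rw [map_one, map_one, sub_self]
    exact Submodule.zero_mem _
  | of i =>
    rw [mem_endFil]
    intro p f hf
    rw [LinearMap.sub_apply, Module.End.one_apply]
    fin_cases i
    · convert! diff_mem_diffFil hf using 1
      exact funext fun n => congrArg (· - f n) (repVB_X_zero k y c hc f n)
    · convert! mul_right_mem_diffFil hy (apply_mem_of_mem_diffFil hf 0) using 1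
      · rw [add_comm]
      · exact funext fun n => (congrArg (· - f n) (repVB_X_one k y c hc f n)).trans
          (add_sub_cancel_left _ _)
  | inv_of i _ =>
    rw [mem_endFil, of_inv_eq_Xpow]
    intro p f hf
    rw [LinearMap.sub_apply, Module.End.one_apply]
    fin_cases i
    · convert! Submodule.neg_mem _ (translate_mem_diffFil (diff_mem_diffFil hf) (-1)) using 1
      refine funext fun n => (congrArg (· - f n) (repVB_X_zero_inv k y c hc f n)).trans ?_
      rw [Pi.neg_apply, diff_apply, neg_add_cancel_right, neg_sub, ← sub_eq_add_neg]
    · convert! Submodule.neg_mem _ (mul_right_mem_diffFil hy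
        (Φ.mul_mem hc' (apply_mem_of_mem_diffFil hf 0))) using 1
      · rw [zero_add, add_comm]
      · refine funext fun n => (congrArg (· - f n) (repVB_X_one_inv k y c hc f n)).trans ?_
        rw [Pi.neg_apply, mul_assoc]
        abel
  | mul a b ha hb =>
    rw [map_mul, map_mul, mul_sub_one_eq]
    exact Submodule.add_mem _ (Submodule.add_mem _
      ((endFil Φ).anti (by lia) ((endFil Φ).mul_mem ha hb)) ha) hb

theorem isFiltered_repVB (y : ℤ → A) (c : Aˣ) (hc : (c : A) = 1 + y 0)
    (hy : y ∈ diffFil Φ 1) (hc' : ((c⁻¹ : Aˣ) : A) ∈ Φ.F 0) :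
    IsFiltered (filVB k) (endFil Φ) (repVB k y c hc) := by
  have h := repVB_of_sub_one_mem_endFil Φ y c hc hy hc'
  refine filVB_F_induction k _ _ (fun x => ?_) h
  induction x using MonoidAlgebra.induction_on with
  | of g =>
    have := Submodule.add_mem _ ((endFil Φ).anti zero_le_one (h g)) (endFil Φ).one_mem
    rwa [map_sub, map_one, sub_add_cancel] at this
  | add a b ha hb => rw [map_add]; exact Submodule.add_mem _ ha hb
  | smul r a ha => rw [map_smul]; exact Submodule.smul_mem _ r ha

theorem isFiltered_liftWB (y : ℤ → A) (c : Aˣ) (hc : (c : A) = 1 + y 0)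
    (hy : y ∈ diffFil Φ 1) (hc' : ((c⁻¹ : Aˣ) : A) ∈ Φ.F 0) :
    IsFiltered (filWB k) Φ (liftWB k y c hc) := by
  intro n w hw
  -- The lift sends w to the value at 0 of its action on the constant function 1, which has degree 0
  -- because its differences vanish.
  have h := (mem_endFil Φ).1 (isFiltered_repVB Φ y c hc hy hc' n w hw) 0 1 (one_mem_diffFil Φ)
  rw [zero_add] at h
  exact apply_mem_of_mem_diffFil h 0

/-! ## Convolution -/

/-- The sign convention for reversed ranges is what makes this recursion hold for every integer q,
so that differences in n can be computed uniformly. -/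
theorem intSum_add_one {M : Type v} [AddCommGroup M] (p q : ℤ) (f : ℤ → M) :
    intSum p (q + 1) f = intSum p q f + f (q + 1) := by
  rcases lt_trichotomy (p - 1) (q + 1) with h | h | h
  · rw [intSum, intSum, if_pos h.le, if_pos (by lia)]
    have : Finset.Icc p (q + 1) = insert (q + 1) (Finset.Icc p q) := by
      ext a
      simp only [Finset.mem_Icc, Finset.mem_insert]
      lia
    rw [this, Finset.sum_insert (by simp), add_comm]
  -- Boundary case q + 1 = p - 1: the left sum is empty, while the right side is -f(q+1) + f(q+1).
  · rw [intSum, intSum, if_pos h.le, if_neg (by lia), h, Finset.Icc_self, Finset.sum_singleton,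
      neg_add_cancel, Finset.Icc_eq_empty (by lia), Finset.sum_empty]
  · rw [intSum, intSum, if_neg (by lia), if_neg (by lia)]
    have : Finset.Icc (q + 1) (p - 1) = insert (q + 1) (Finset.Icc (q + 1 + 1) (p - 1)) := by
      ext a
      simp only [Finset.mem_Icc, Finset.mem_insert]
      lia
    rw [this, Finset.sum_insert (by simp)]
    abel

theorem intSum_sub {M : Type v} [AddCommGroup M] (p q : ℤ) (f g : ℤ → M) :
    intSum p q (fun a => f a - g a) = intSum p q f - intSum p q g := by
  unfold intSum
  split_ifs
  · exact Finset.sum_sub_distrib _ _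
  · rw [Finset.sum_sub_distrib]
    abel

theorem intSum_mem (N : Submodule k A) (p q : ℤ) (f : ℤ → A) (h : ∀ a, f a ∈ N) :
    intSum p q f ∈ N := by
  unfold intSum
  split_ifs
  · exact N.sum_mem fun a _ => h a
  · exact N.neg_mem (N.sum_mem fun a _ => h a)

variable (k) in
/-- The convolution `n ↦ ∑_{a=1}^{n-1} f(a) ⊗ g(n-a)`. -/
def conv (f : ℤ → A) (g : ℤ → B) (n : ℤ) : A ⊗[k] B :=
  intSum 1 (n - 1) fun a => f a ⊗ₜ[k] g (n - a)

/-- In f(a) ⊗ g(n-a) only g depends on n, so differences fall on g; raising the upper limit to n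
adds the boundary term f(n) ⊗ g(1). -/
theorem diff_conv (f : ℤ → A) (g : ℤ → B) :
    diff k (A ⊗[k] B) (conv k f g) = conv k f (diff k B g) + fun n => f n ⊗ₜ g 1 := by
  ext n
  rw [diff_apply, Pi.add_apply, conv, conv, conv, show n + 1 - 1 = n - 1 + 1 by ring,
    intSum_add_one, add_sub_right_comm, ← intSum_sub, show n + 1 - (n - 1 + 1) = 1 by ring,
    sub_add_cancel]
  congr 2
  funext a
  rw [diff_apply, TensorProduct.tmul_sub, show n + 1 - a = n - a + 1 by ring]

theorem diff_pow_tmul (f : ℤ → A) (b : B) (m : ℕ) (n : ℤ) :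
    (diff k (A ⊗[k] B) ^ m) (fun i => f i ⊗ₜ b) n = (diff k A ^ m) f n ⊗ₜ b :=
  diff_pow_linearMap ((TensorProduct.mk k A B).flip b) f m n

theorem diff_pow_tmul' (a : A) (f : ℤ → B) (m : ℕ) (n : ℤ) :
    (diff k (A ⊗[k] B) ^ m) (fun i => a ⊗ₜ f i) n = a ⊗ₜ (diff k B ^ m) f n :=
  diff_pow_linearMap (TensorProduct.mk k A B a) f m n

theorem diff_pow_conv (f : ℤ → A) (g : ℤ → B) (m : ℕ) (n : ℤ) :
    (diff k (A ⊗[k] B) ^ m) (conv k f g) n = conv k f ((diff k B ^ m) g) n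
      + ∑ j ∈ Finset.range m, (diff k A ^ (m - 1 - j)) f n ⊗ₜ (diff k B ^ j) g 1 := by
  induction m generalizing n with
  | zero => simp
  | succ m ih =>
    rw [diff_pow_succ_apply', diff_apply, ih, ih, add_sub_add_comm, ← diff_apply (k := k), diff_conv,
      Pi.add_apply, ← diff_pow_succ_apply', ← Finset.sum_sub_distrib, Finset.sum_range_succ,
      add_tsub_cancel_right, tsub_self, add_assoc, add_comm (f n ⊗ₜ[k] _)]
    congr 2
    refine Finset.sum_congr rfl fun j hj => ?_
    rw [Finset.mem_range] at hj
    rw [← TensorProduct.sub_tmul, ← diff_apply (k := k), ← diff_pow_succ_apply',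
      show m - 1 - j + 1 = m - j by lia]

theorem diff_pow_tmul_add_tmul_sub_conv (f : ℤ → A) (a : A) (g : ℤ → B) (b : B) (m : ℕ) (n : ℤ) :
    (diff k (A ⊗[k] B) ^ m) ((fun n => f n ⊗ₜ[k] b) + (fun n => a ⊗ₜ[k] g n) - conv k f g) n
      = (diff k A ^ m) f n ⊗ₜ[k] b + a ⊗ₜ[k] (diff k B ^ m) g n
        - (conv k f ((diff k B ^ m) g) n
          + ∑ j ∈ Finset.range m, (diff k A ^ (m - 1 - j)) f n ⊗ₜ (diff k B ^ j) g 1) := by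
  rw [map_sub, map_add, Pi.sub_apply, Pi.add_apply, diff_pow_tmul, diff_pow_tmul', diff_pow_conv]

variable {Φ Ψ}

theorem conv_apply_mem {p q : ℤ} {f : ℤ → A} {g : ℤ → B} (hf : ∀ n, f n ∈ Φ.F p)
    (hg : ∀ n, g n ∈ Ψ.F q) (n : ℤ) : conv k f g n ∈ (Φ.tensor Ψ).F (p + q) :=
  intSum_mem ((Φ.tensor Ψ).F (p + q)) _ _ _ fun _ => tmul_mem_tensor (hf _) (hg _)

theorem tmul_mem_diffFil {p q : ℤ} {f : ℤ → A} (hf : f ∈ diffFil Φ p) {b : B} (hb : b ∈ Ψ.F q) :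
    (fun n => f n ⊗ₜ[k] b) ∈ diffFil (Φ.tensor Ψ) (p + q) :=
  linearMap_mem_diffFil hf ((TensorProduct.mk k A B).flip b) fun _ _ ha => tmul_mem_tensor ha hb

theorem tmul_mem_diffFil' {p q : ℤ} {a : A} (ha : a ∈ Φ.F q) {g : ℤ → B}
    (hg : g ∈ diffFil Ψ p) : (fun n => a ⊗ₜ[k] g n) ∈ diffFil (Φ.tensor Ψ) (p + q) :=
  linearMap_mem_diffFil hg (TensorProduct.mk k A B a) fun n b hb => by
    rw [add_comm]
    exact tmul_mem_tensor ha hb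

/-- Values already lie in degree p + q, but one difference leaves the boundary term f(n) ⊗ g(1),
again only of degree p + q: this accounts for the loss of one. The induction lets g vary, since
`diff_conv` replaces g by its difference, of degree q + 1. -/
theorem conv_mem_diffFil {p q : ℤ} {f : ℤ → A} {g : ℤ → B} (hf : f ∈ diffFil Φ p)
    (hg : g ∈ diffFil Ψ q) : conv k f g ∈ diffFil (Φ.tensor Ψ) (p + q - 1) := by
  intro m
  induction m generalizing q g with
  | zero =>
    intro n
    exact (Φ.tensor Ψ).anti (by lia) (conv_apply_mem (apply_mem_of_mem_diffFil hf)
      (apply_mem_of_mem_diffFil hg) n)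
  | succ m ih =>
    intro n
    rw [diff_pow_succ_apply, diff_conv, map_add]
    refine Submodule.add_mem _ ?_ ?_
    · have := ih (diff_mem_diffFil hg) n
      rwa [show p + (q + 1) - 1 + (m : ℤ) = p + q - 1 + ((m + 1 : ℕ) : ℤ) by push_cast; ring]
        at this
    · have := tmul_mem_diffFil hf (apply_mem_of_mem_diffFil hg 1) m n
      rwa [show p + q + (m : ℤ) = p + q - 1 + ((m + 1 : ℕ) : ℤ) by push_cast; ring] at this

end Differences

/-! ## The harmonic coproducts -/

section Coproducts

variable (k : Type u) [CommRing k]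

/-! ### Differences of n ↦ X_0^n (X_1 - 1) and their symbols. -/

theorem coe_diff_pow_yB (m : ℕ) (n : ℤ) :
    ((diff k (WB k) ^ m) (yB k) n : VB k)
      = Xpow k 0 n * ((X k 0 - 1) ^ m * (X k 1 - 1)) := by
  induction m generalizing n with
  | zero =>
    rw [pow_zero, pow_zero, one_mul]
    rfl
  | succ m ih =>
    rw [diff_pow_succ_apply', diff_apply, Subalgebra.coe_sub, ih, ih, Xpow_add, Xpow_one,
      pow_succ' (X k 0 - 1)]
    noncomm_ring

theorem X_sub_one_pow_mem (i : Fin 2) (m : ℕ) : (X k i - 1) ^ m ∈ (filVB k).F m := by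
  induction m with
  | zero => rw [pow_zero]; exact (filVB k).one_mem
  | succ m ih =>
    rw [pow_succ, Nat.cast_succ]
    exact (filVB k).mul_mem ih (X_sub_one_mem k i)

theorem zcoeff_magnus_mul {m n : ℤ} {a b : VB k} (ha : a ∈ (filVB k).F m)
    (hb : b ∈ (filVB k).F n) :
    zcoeff k (m + n) (magnus k (a * b)) = zcoeff k m (magnus k a) * zcoeff k n (magnus k b) := by
  rw [map_mul, zcoeff_mul k ((mem_ordFil k).1 (isFiltered_magnus k m a ha))
    ((mem_ordFil k).1 (isFiltered_magnus k n b hb))]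

theorem zcoeff_magnus_X_sub_one_pow (i : Fin 2) (m : ℕ) :
    zcoeff k m (magnus k ((X k i - 1) ^ m)) = e k i ^ m := by
  induction m with
  | zero => rw [pow_zero, pow_zero, map_one, Nat.cast_zero, zcoeff_one, if_pos rfl]
  | succ m ih =>
    rw [pow_succ, pow_succ, Nat.cast_succ,
      zcoeff_magnus_mul k (X_sub_one_pow_mem k i m) (X_sub_one_mem k i), ih,
      zcoeff_magnus_X_sub_one]

theorem Xpow_mem (i : Fin 2) (n : ℤ) : Xpow k i n ∈ (filVB k).F 0 := by
  rw [filVB_F_of_nonpos k le_rfl]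
  exact Submodule.mem_top

theorem zcoeff_zero_magnus_Xpow (i : Fin 2) (n : ℤ) : zcoeff k 0 (magnus k (Xpow k i n)) = 1 := by
  rw [← Nat.cast_zero, zcoeff_natCast, PowerSeries.coeff_zero_eq_constantCoeff_apply]
  exact constantCoeff_magnus_of k _

theorem diff_pow_yB_mem (m : ℕ) (n : ℤ) :
    (diff k (WB k) ^ m) (yB k) n ∈ (filWB k).F (1 + m) := by
  change ((diff k (WB k) ^ m) (yB k) n : VB k) ∈ (filVB k).F (1 + m)
  rw [coe_diff_pow_yB, add_comm, ← zero_add ((m : ℤ) + 1)]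
  exact (filVB k).mul_mem (Xpow_mem k 0 n)
    ((filVB k).mul_mem (X_sub_one_pow_mem k 0 m) (X_sub_one_mem k 1))

/-- The symbol does not depend on n because X_0^n has symbol 1 in degree zero. -/
theorem zcoeff_magnusW_diff_pow_yB (m : ℕ) (n : ℤ) :
    zcoeff k (1 + m) (magnusW k ((diff k (WB k) ^ m) (yB k) n)) = yDR k m := by
  refine Subtype.ext ?_
  rw [coe_zcoeff_magnusW, coe_diff_pow_yB, add_comm, ← zero_add ((m : ℤ) + 1),
    zcoeff_magnus_mul k (Xpow_mem k 0 n)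
      ((filVB k).mul_mem (X_sub_one_pow_mem k 0 m) (X_sub_one_mem k 1)),
    zcoeff_magnus_mul k (X_sub_one_pow_mem k 0 m) (X_sub_one_mem k 1), zcoeff_zero_magnus_Xpow,
    zcoeff_magnus_X_sub_one_pow, zcoeff_magnus_X_sub_one, one_mul]
  rfl

theorem yB_mem_diffFil : yB k ∈ diffFil (filWB k) 1 := diff_pow_yB_mem k

/-- The values of the Betti harmonic coproduct on the elements `X_0^n (X_1 - 1)`. -/
def coproductYB (n : ℤ) : WB k ⊗[k] WB k :=
  yB k n ⊗ₜ[k] 1 + 1 ⊗ₜ[k] yB k n - conv k (yB k) (yB k) n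

theorem coproductYB_eq : coproductYB k = (fun n => yB k n ⊗ₜ[k] 1) + (fun n => 1 ⊗ₜ[k] yB k n)
    - conv k (yB k) (yB k) := rfl

theorem coproductYB_mem_diffFil : coproductYB k ∈ diffFil (filWWB k) 1 := by
  have h := yB_mem_diffFil k
  have h1 := tmul_mem_diffFil (Ψ := filWB k) h (filWB k).one_mem
  have h2 := tmul_mem_diffFil' (Φ := filWB k) (filWB k).one_mem h
  have h3 := conv_mem_diffFil h h
  rw [add_zero] at h1 h2
  -- The degree 1 + 1 - 1 of the convolution matches the degree 1 of the two linear terms.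
  rw [add_sub_cancel_right] at h3
  rw [coproductYB_eq]
  exact Submodule.sub_mem _ (Submodule.add_mem _ h1 h2) h3

/-- The element `X_1 ⊗ X_1` of `W^B ⊗ W^B`, as a unit. -/
def tensorX1 : (WB k ⊗[k] WB k)ˣ where
  val := (1 + yB k 0) ⊗ₜ (1 + yB k 0)
  inv := X1inv k ⊗ₜ X1inv k
  val_inv := by
    rw [Algebra.TensorProduct.tmul_mul_tmul, mul_X1inv, Algebra.TensorProduct.one_def]
  inv_val := by
    rw [Algebra.TensorProduct.tmul_mul_tmul, X1inv_mul, Algebra.TensorProduct.one_def]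

theorem tensorX1_eq : (tensorX1 k : WB k ⊗[k] WB k) = 1 + coproductYB k 0 := by
  -- At n = 0 the sum from 1 to -1 is, by the sign convention, minus its term at a = 0; this
  -- supplies the y_0 ⊗ y_0 in (1 + y_0) ⊗ (1 + y_0).
  have h : conv k (yB k) (yB k) 0 = -(yB k 0 ⊗ₜ[k] yB k 0) := by
    rw [conv, intSum, if_neg (by lia), show (0 : ℤ) - 1 + 1 = 0 by lia,
      show (1 : ℤ) - 1 = 0 by lia, Finset.Icc_self, Finset.sum_singleton, sub_zero]
  change (1 + yB k 0) ⊗ₜ (1 + yB k 0) = _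
  rw [coproductYB, h, TensorProduct.add_tmul, TensorProduct.tmul_add, TensorProduct.tmul_add,
    Algebra.TensorProduct.one_def]
  abel

/-- The Betti harmonic coproduct. -/
def coproductB : WB k →ₐ[k] WB k ⊗[k] WB k :=
  liftWB k (coproductYB k) (tensorX1 k) (tensorX1_eq k)

theorem coproductB_yB (n : ℤ) : coproductB k (yB k n) = coproductYB k n :=
  liftWB_yB k _ _ _ n

theorem coproductB_X1inv : coproductB k (X1inv k) = X1inv k ⊗ₜ[k] X1inv k := by
  have h := congrArg (coproductB k) (X1inv_mul k)
  rw [map_mul, map_add, map_one, coproductB_yB, ← tensorX1_eq] at h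
  exact Units.eq_inv_of_mul_eq_one_right h

theorem isBettiCoproduct_iff (Δ : WB k →ₐ[k] WB k ⊗[k] WB k) :
    IsBettiCoproduct k Δ ↔ Δ = coproductB k := by
  constructor
  · intro h
    exact algHom_WB_ext k (A := WB k ⊗[k] WB k) (f := Δ) (g := coproductB k)
      (h.1.trans (coproductB_X1inv k).symm)
      fun n => (h.2 n).trans (coproductB_yB k n).symm
  · rintro rfl
    exact ⟨coproductB_X1inv k, coproductB_yB k⟩

theorem isFiltered_coproductB : IsFiltered (filWB k) (filWWB k) (coproductB k) :=
  isFiltered_liftWB (filWWB k) _ _ _ (coproductYB_mem_diffFil k)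
    (tmul_mem_filWWB k (m := 0) (n := 0) (Xpow_mem k 1 (-1)) (Xpow_mem k 1 (-1)))

/-- The de Rham harmonic coproduct. -/
def coproductDR : WDR k →ₐ[k] WDR k ⊗[k] WDR k :=
  liftWDR k fun n => yDR k n ⊗ₜ[k] 1 + 1 ⊗ₜ[k] yDR k n
    - ∑ a ∈ Finset.range n, yDR k a ⊗ₜ[k] yDR k (n - a - 1)

theorem coproductDR_yDR (n : ℕ) : coproductDR k (yDR k n) = yDR k n ⊗ₜ[k] 1 + 1 ⊗ₜ[k] yDR k n
    - ∑ a ∈ Finset.range n, yDR k a ⊗ₜ[k] yDR k (n - a - 1) :=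
  liftWDR_yDR k _ n

theorem isDeRhamCoproduct_iff (Δ : WDR k →ₐ[k] WDR k ⊗[k] WDR k) :
    IsDeRhamCoproduct k Δ ↔ Δ = coproductDR k := by
  constructor
  · intro h
    exact algHom_WDR_ext k (f := Δ) (g := coproductDR k)
      fun n => (h n).trans (coproductDR_yDR k n).symm
  · rintro rfl
    exact coproductDR_yDR k

/-! ### Identification of the associated graded Betti coproduct with the de Rham coproduct. -/

/-- The associated graded morphism of the Betti harmonic coproduct, transported to `W^DR`. -/
def grCoproductB : WDR k →ₐ[k] WDR k ⊗[k] WDR k :=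
  ((isoWW k).toAlgHom.comp (grMap (filWB k) (filWWB k) (coproductB k)
    (isFiltered_coproductB k))).comp (isoW k).symm.toAlgHom

theorem grCoproductB_isoW (x : Gr (filWB k)) : grCoproductB k (isoW k x)
    = isoWW k (grMap (filWB k) (filWWB k) (coproductB k) (isFiltered_coproductB k) x) :=
  congrArg (fun z => isoWW k (grMap (filWB k) (filWWB k) (coproductB k)
    (isFiltered_coproductB k) z)) ((isoW k).symm_apply_apply x)

/-- A linear map commutes with differences, so the m-th difference of the defining formula gives the
coproduct of X_0^n (X_0 - 1)^m (X_1 - 1), a lift of e_0^m e_1. -/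
theorem coproductB_diff_pow_yB (m : ℕ) (n : ℤ) :
    coproductB k ((diff k (WB k) ^ m) (yB k) n) = (diff k (WB k) ^ m) (yB k) n ⊗ₜ[k] 1
      + 1 ⊗ₜ[k] (diff k (WB k) ^ m) (yB k) n - (conv k (yB k) ((diff k (WB k) ^ m) (yB k)) n
      + ∑ j ∈ Finset.range m,
        (diff k (WB k) ^ (m - 1 - j)) (yB k) n ⊗ₜ (diff k (WB k) ^ j) (yB k) 1) := by
  have h : (fun i => (coproductB k).toLinearMap (yB k i)) = coproductYB k :=
    funext (coproductB_yB k)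
  refine (diff_pow_linearMap (A := WB k) (B := WB k ⊗[k] WB k) (coproductB k).toLinearMap
    (yB k) m n).symm.trans ?_
  rw [h, coproductYB_eq]
  exact diff_pow_tmul_add_tmul_sub_conv (yB k) 1 (yB k) 1 m n

theorem isDeRhamCoproduct_grCoproductB : IsDeRhamCoproduct k (grCoproductB k) := by
  intro n
  have hy := diff_pow_yB_mem k
  have h1 : (1 : WB k) ∈ (filWB k).F 0 := (filWB k).one_mem
  have h1' : zcoeff k 0 (magnusW k 1) = 1 := by rw [map_one, zcoeff_one, if_pos rfl]
  have e1 := zcoeff_magnusWW k (hy n 0) h1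
  rw [add_zero, h1', zcoeff_magnusW_diff_pow_yB] at e1
  have e2 := zcoeff_magnusWW k h1 (hy n 0)
  rw [zero_add, h1', zcoeff_magnusW_diff_pow_yB] at e2
  -- All n differences fall on the second factor, so this term lies in F^(n+2), one step beyond the
  -- degree being read.
  have e3 : zcoeff k (1 + n) (magnusWW k (conv k (yB k) ((diff k (WB k) ^ n) (yB k)) 0)) = 0 := by
    have h : conv k (yB k) ((diff k (WB k) ^ n) (yB k)) 0 ∈ (filWWB k).F (1 + (1 + n)) :=
      conv_apply_mem (apply_mem_of_mem_diffFil (yB_mem_diffFil k)) (hy n) 0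
    exact (mem_ordFil k).1 (isFiltered_magnusWW k _ _ h) _ (by lia)
  have e4 : ∀ j ∈ Finset.range n, zcoeff k (1 + n) (magnusWW k
      ((diff k (WB k) ^ (n - 1 - j)) (yB k) 0 ⊗ₜ (diff k (WB k) ^ j) (yB k) 1))
        = yDR k (n - 1 - j) ⊗ₜ yDR k j := by
    intro j hj
    rw [Finset.mem_range] at hj
    have h := zcoeff_magnusWW k (hy (n - 1 - j) 0) (hy j 1)
    rwa [zcoeff_magnusW_diff_pow_yB, zcoeff_magnusW_diff_pow_yB,
      show (1 + ((n - 1 - j : ℕ) : ℤ)) + (1 + (j : ℤ)) = 1 + n by lia] at h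
  have e5 : yDR k n = isoW k (grCls (filWB k) (1 + n) _ (hy n 0)) := by
    rw [isoW_grCls, zcoeff_magnusW_diff_pow_yB]
  have e6 : grCoproductB k (yDR k n) = zcoeff k (1 + n)
      (magnusWW k (coproductB k ((diff k (WB k) ^ n) (yB k) 0))) := by
    rw [e5, grCoproductB_isoW, grMap_grCls, isoWW_grCls]
  rw [e6, coproductB_diff_pow_yB, map_sub, map_add, map_add, map_sub, map_add, map_add, e1, e2, e3,
    zero_add, map_sum, map_sum, Finset.sum_congr rfl e4]
  congr 1
  -- The boundary terms carry j in the second tensor factor, whereas the de Rham sum is indexed by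
  -- the first; j ↦ n - 1 - j exchanges them.
  rw [← Finset.sum_range_reflect]
  refine Finset.sum_congr rfl fun j hj => ?_
  rw [Finset.mem_range] at hj
  rw [show n - 1 - (n - 1 - j) = j by lia, show n - j - 1 = n - 1 - j by lia]

theorem grCoproductB_eq : grCoproductB k = coproductDR k :=
  (isDeRhamCoproduct_iff k _).1 (isDeRhamCoproduct_grCoproductB k)

theorem isoWW_grMap_coproductB (x : Gr (filWB k)) :
    isoWW k (grMap (filWB k) (filWWB k) (coproductB k) (isFiltered_coproductB k) x)
      = coproductDR k (isoW k x) := by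
  rw [← grCoproductB_isoW, grCoproductB_eq]

/-- Homogeneity is transported through the isomorphisms from gr of the Betti coproduct, which
preserves degrees by construction. -/
theorem map_coproductDR_degWDR_le (n : ℤ) :
    (degWDR k n).map (coproductDR k).toLinearMap ≤ degWWDR k n := by
  rw [← map_isoW_grDeg, ← map_isoWW_grDeg]
  rintro _ ⟨_, ⟨x, hx, rfl⟩, rfl⟩
  exact ⟨_, grMap_mem_grDeg _ _ _ (isFiltered_coproductB k) hx, isoWW_grMap_coproductB k x⟩

end Coproducts

end HarmonicCoproduct

end

open HarmonicCoproduct in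
/-- The harmonic coproducts `Δ^{W,B}`, `Δ^{W,DR}` and the graded algebra isomorphisms
`φ : gr(V^B) ≃ V^DR`, `ψ : gr(W^B) ≃ W^DR`, `χ : gr(W^B ⊗ W^B) ≃ W^DR ⊗ W^DR` exist and are
uniquely determined by their defining properties, `Δ^{W,B}` is filtered, `Δ^{W,DR}` is graded, and
`χ ∘ gr(Δ^{W,B}) = Δ^{W,DR} ∘ ψ`. -/
theorem mainTheorem8 (k : Type*) [CommRing k] [Algebra ℚ k] :
    ∃ (ΔB : WB k →ₐ[k] WB k ⊗[k] WB k) (ΔDR : WDR k →ₐ[k] WDR k ⊗[k] WDR k)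
      (φ : Gr (filVB k) ≃ₐ[k] VDR k) (ψ : Gr (filWB k) ≃ₐ[k] WDR k)
      (χ : Gr (filWWB k) ≃ₐ[k] WDR k ⊗[k] WDR k),
      (∀ Δ : WB k →ₐ[k] WB k ⊗[k] WB k, IsBettiCoproduct k Δ ↔ Δ = ΔB) ∧
      (∀ Δ : WDR k →ₐ[k] WDR k ⊗[k] WDR k, IsDeRhamCoproduct k Δ ↔ Δ = ΔDR) ∧
      (∀ φ' : Gr (filVB k) ≃ₐ[k] VDR k, IsGrIsoV φ' ↔ φ' = φ) ∧
      (∀ ψ' : Gr (filWB k) ≃ₐ[k] WDR k, IsGrIsoW φ ψ' ↔ ψ' = ψ) ∧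
      (∀ χ' : Gr (filWWB k) ≃ₐ[k] WDR k ⊗[k] WDR k, IsGrIsoWW ψ χ' ↔ χ' = χ) ∧
      (∀ n : ℤ, (degWDR k n).map ΔDR.toLinearMap ≤ degWWDR k n) ∧
      ∃ hfil : IsFiltered (filWB k) (filWWB k) ΔB,
        ∀ x : Gr (filWB k), χ (grMap (filWB k) (filWWB k) ΔB hfil x) = ΔDR (ψ x) :=
  ⟨coproductB k, coproductDR k, isoV k, isoW k, isoWW k, isBettiCoproduct_iff k,
    isDeRhamCoproduct_iff k, isGrIsoV_iff k, isGrIsoW_iff k, isGrIsoWW_iff k,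
    map_coproductDR_degWDR_le k, isFiltered_coproductB k, isoWW_grMap_coproductB k⟩
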